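/- **Setting.** Let $n\ge 1$, $m\ge 0$ be integers and $T>0$. For every SNR $\rho$ let $\boldsymbol H\in\mathbb R^{m\times n}$ be a random matrix with an arbitrary law $\mu_\rho$, and let $\boldsymbol y=\boldsymbol H\boldsymbol x+\boldsymbol w$ with $\boldsymbol w\sim\mathcal N(\boldsymbol 0,\boldsymbol I_m)$ and $\boldsymbol x,\boldsymbol H,\boldsymbol w$ independent. A lattice design is a pair $(\Lambda,\mathcal R)$ where $\Lambda=\boldsymbol G\mathbb Z^n$ with $\boldsymbol G\in\mathbb R^{n\times n}$ invertible, and $\mathcal R\subset\mathbb R^n$ is compact and convex with $\boldsymbol 0$ in its interior. For $r\ge 0$ and $\rho>0$ put $\phi_r=\rho^{-rT/n}$, $\Lambda_r=\phi_r\Lambda$, $\mathcal X_r=\Lambda_r\cap\mathcal R$; the codeword $\boldsymbol x$ is uniform on $\mathcal X_r$. The ML decoder minimizes $\|\boldsymbol y-\boldsymbol H\hat{\boldsymbol x}\|^2$ over $\hat{\boldsymbol x}\in\mathcal X_r$ (ties broken measurably, in any way), and $$d_{\mathrm{ML}}(r)=-\lim_{\rho\to\infty}\frac{\log \mathrm P(\hat{\boldsymbol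 x}_{\mathrm{ML}}\ne\boldsymbol x)}{\log\rho}\in[0,\infty]$$ when the limit exists. Let $\boldsymbol S\in\mathbb R^{n\times n}$ be a fixed symmetric positive definite matrix, and let $\xi(\hat{\boldsymbol x})=\|\boldsymbol y-\boldsymbol H\hat{\boldsymbol x}\|^2+\hat{\boldsymbol x}^{\mathrm T}\boldsymbol S\hat{\boldsymbol x}$ be the metric of the regularized lattice decoder ($\boldsymbol S=\boldsymbol I$ is the MMSE-GDFE case). **LR-aided decoders.** Given $\boldsymbol y$ and $\boldsymbol H$, take $\boldsymbol B\in\mathbb R^{n\times n}$ with $\boldsymbol B^{\mathrm T}\boldsymbol B=\boldsymbol H^{\mathrm T}\boldsymbol H+\boldsymbol S$, put $\boldsymbol F=\boldsymbol B^{-\mathrm T}\boldsymbol H^{\mathrm T}$, and let $\boldsymbol M=\boldsymbol B\boldsymbol G\boldsymbol U$, with $\boldsymbol U$ unimodular, be an LLL-reduced basis (parameter $3/4$) of the lattice $\boldsymbol B\boldsymbol G\mathbb Z^n$. In the basis $\phi_r\boldsymbol M$, with target $\boldsymbol F\boldsymbol y$, compute $\boldsymbol z\in\mathbb Z^n$,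 either by rounding each entry of $(\phi_r\boldsymbol M)^{-1}\boldsymbol F\boldsymbol y$ to a nearest integer (the LR-aided linear decoder, Babai rounding), or by Babai's nearest plane procedure (the LR-aided SIC decoder), and return $\hat{\boldsymbol x}=\phi_r\boldsymbol G\boldsymbol U\boldsymbol z\in\Lambda_r$. The choices of $\boldsymbol B$, of $\boldsymbol U$, and of the nearest integer in case of a tie are arbitrary and may depend on $\rho,\boldsymbol y,\boldsymbol H$. **Claim.** For every lattice design and every such $\boldsymbol S$: 1. For all $r\ge 0$ and $\rho>0$ decoders of both kinds exist. For all $\boldsymbol y$, $\boldsymbol H$, their outputs $\hat{\boldsymbol x}\in\Lambda_r$ satisfy $\xi(\hat{\boldsymbol x})\le C^2\,\xi(\boldsymbol x')$ for all $\boldsymbol x'\in\Lambda_r$, with $C=1+2n(9/2)^{n/2}$ for every LR-aided linear decoder and $C=2^{n/2}$ for every LR-aided SIC decoder; that is, they are within the factor $C$ of the optimum in terms of $\sqrt{\xi}$. 2. Both kinds of decoders are DMT optimal: for every family of fading laws $\mu_\rho$ and every $r\ge0$ such that $d_{\mathrm{ML}}$ exists on some interval $[r,r+\varepsilon)$, $\varepsilon>0$,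 and is right continuous at $r$ (as a function with values in $[0,\infty]$), every LR-aided linear decoder and every LR-aided SIC decoder satisfies $$-\lim_{\rho\to\infty}\frac{\log \mathrm P(\hat{\boldsymbol x}\ne\boldsymbol x)}{\log\rho}=d_{\mathrm{ML}}(r),$$ the limit existing in $[0,\infty]$. -/

import Mathlib

open MeasureTheory ProbabilityTheory Filter Topology
open scoped ENNReal

namespace LatticeDMT

/-- The coordinatewise (Borel) measurable structure on real matrices. -/
instance instMeasurableSpaceRealMatrix {m n : ℕ} :
    MeasurableSpace (Matrix (Fin m) (Fin n) ℝ) :=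
  inferInstanceAs (MeasurableSpace (Fin m → Fin n → ℝ))

/-! ### Channel, codes, error probabilities and diversity -/

/-- A lattice design: a full-rank lattice, given by a square generator matrix, together with a
shaping region, i.e. a compact convex set having the origin in its interior. -/
structure LatticeDesign (n : ℕ) where
  /-- the generator matrix of the lattice -/
  G : Matrix (Fin n) (Fin n) ℝ
  G_fullRank : IsUnit G.det
  /-- the shaping region -/
  region : Set (EuclideanSpace ℝ (Fin n))
  region_compact : IsCompact region
  region_convex : Convex ℝ region
  zero_mem_interior : (0 : EuclideanSpace ℝ (Fin n)) ∈ interior region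

/-- The vector `A z`, for an integer vector `z`. -/
noncomputable def intComb {n : ℕ} (A : Matrix (Fin n) (Fin n) ℝ) (z : Fin n → ℤ) :
    EuclideanSpace ℝ (Fin n) :=
  A.toEuclideanLin (WithLp.toLp 2 (fun i => (z i : ℝ)))

/-- The scaling `φ_r = ρ ^ (-rT/n)`. -/
noncomputable def scaling (n : ℕ) (T r ρ : ℝ) : ℝ := ρ ^ (-(r * T) / (n : ℝ))

namespace LatticeDesign

variable {n : ℕ}

/-- The scaled lattice `Λ_r = φ_r Λ` with `Λ = G ℤⁿ`. -/
noncomputable def scaledLattice (L : LatticeDesign n) (T r ρ : ℝ) :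
    Set (EuclideanSpace ℝ (Fin n)) :=
  {x | ∃ z : Fin n → ℤ, x = scaling n T r ρ • intComb L.G z}

/-- The codebook `X_r = Λ_r ∩ R`. -/
noncomputable def codebook (L : LatticeDesign n) (T r ρ : ℝ) :
    Set (EuclideanSpace ℝ (Fin n)) :=
  L.scaledLattice T r ρ ∩ L.region

end LatticeDesign

/-- A decoder maps the received vector `y` and the channel matrix `H` to a vector. -/
abbrev Decoder (m n : ℕ) : Type :=
  EuclideanSpace ℝ (Fin m) → Matrix (Fin m) (Fin n) ℝ → EuclideanSpace ℝ (Fin n)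

/-- The codeword error probability `P(x̂ ≠ x)` of the decoder `D` over `y = H x + w`, where `x` is
uniform on the codebook `X`, `H` has law `μ`, the noise `w` is standard Gaussian, and
`x`, `H`, `w` are independent. -/
noncomputable def errorProb {m n : ℕ} (X : Set (EuclideanSpace ℝ (Fin n)))
    (μ : Measure (Matrix (Fin m) (Fin n) ℝ)) (D : Decoder m n) : ℝ≥0∞ :=
  ((uniformOn X).prod (μ.prod (stdGaussian (EuclideanSpace ℝ (Fin m)))))
    {p | D (p.2.1.toEuclideanLin p.1 + p.2.2) p.2.1 ≠ p.1}

/-- `-lim_{ρ → ∞} log P(ρ) / log ρ` exists in `[-∞, ∞]` and equals `d` (with `log 0 = -∞`). -/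
def HasDiversity (P : ℝ → ℝ≥0∞) (d : EReal) : Prop :=
  Tendsto (fun ρ : ℝ => -(ENNReal.log (P ρ) / (Real.log ρ : EReal))) atTop (𝓝 d)

/-- `D` is a maximum-likelihood decoder for the codebook `X`: its output minimizes `‖y - H x‖²` over
`X`. Ties may be broken in any (measurable) way. -/
structure IsMLDecoder {m n : ℕ} (X : Set (EuclideanSpace ℝ (Fin n))) (D : Decoder m n) :
    Prop where
  measurable : Measurable
    (fun p : EuclideanSpace ℝ (Fin m) × Matrix (Fin m) (Fin n) ℝ => D p.1 p.2)
  mem : ∀ y H, D y H ∈ X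
  le : ∀ (y : EuclideanSpace ℝ (Fin m)) (H : Matrix (Fin m) (Fin n) ℝ), ∀ x ∈ X,
    ‖y - H.toEuclideanLin (D y H)‖ ^ 2 ≤ ‖y - H.toEuclideanLin x‖ ^ 2

/-- The diversity gain under maximum-likelihood decoding at multiplexing gain `r` exists and
equals `d`; `μ ρ` is the law of the channel matrix at SNR `ρ`. -/
def HasMLDiversity {m n : ℕ} (L : LatticeDesign n) (T : ℝ)
    (μ : ℝ → Measure (Matrix (Fin m) (Fin n) ℝ)) (r : ℝ) (d : EReal) : Prop :=
  ∃ D : ℝ → Decoder m n,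
    (∀ ρ : ℝ, 0 < ρ → IsMLDecoder (L.codebook T r ρ) (D ρ)) ∧
    HasDiversity (fun ρ => errorProb (L.codebook T r ρ) (μ ρ) (D ρ)) d

/-! ### The regularized lattice decoding problem -/

/-- The regularized metric `ξ(x) = ‖y - H x‖² + xᵀ S x`. -/
noncomputable def regMetric {m n : ℕ} (S : Matrix (Fin n) (Fin n) ℝ)
    (y : EuclideanSpace ℝ (Fin m)) (H : Matrix (Fin m) (Fin n) ℝ)
    (x : EuclideanSpace ℝ (Fin n)) : ℝ :=
  ‖y - H.toEuclideanLin x‖ ^ 2 + inner ℝ x (S.toEuclideanLin x)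

/-- `D` is a `C`-approximation of the regularized lattice decoder over the lattice `Λ`: it always
returns a lattice point, whose metric is at most `C` times that of any lattice point. -/
def IsApproxDecoder {m n : ℕ} (C : ℝ) (S : Matrix (Fin n) (Fin n) ℝ)
    (Λ : Set (EuclideanSpace ℝ (Fin n))) (D : Decoder m n) : Prop :=
  ∀ y H, D y H ∈ Λ ∧ ∀ x ∈ Λ, regMetric S y H (D y H) ≤ C * regMetric S y H x

/-- `B` is an MMSE-GDFE feedback filter: `Bᵀ B = Hᵀ H + S`. -/
def IsFeedbackFilter {m n : ℕ} (S : Matrix (Fin n) (Fin n) ℝ) (H : Matrix (Fin m) (Fin n) ℝ)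
    (B : Matrix (Fin n) (Fin n) ℝ) : Prop :=
  B.transpose * B = H.transpose * H + S

/-- The MMSE-GDFE forward filter `F = B⁻ᵀ Hᵀ`. -/
noncomputable def forwardFilter {m n : ℕ} (H : Matrix (Fin m) (Fin n) ℝ)
    (B : Matrix (Fin n) (Fin n) ℝ) : Matrix (Fin n) (Fin m) ℝ :=
  (B⁻¹).transpose * H.transpose

/-! ### LLL-reduced bases and Babai's two decoding stages -/

/-- The `i`-th basis vector, i.e. the `i`-th column of the basis matrix. -/
noncomputable def basisVec {n : ℕ} (M : Matrix (Fin n) (Fin n) ℝ) (i : Fin n) :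
    EuclideanSpace ℝ (Fin n) :=
  WithLp.toLp 2 (fun k => M k i)

/-- The Gram-Schmidt orthogonalization (without normalization) `b₁*, …, bₙ*` of the columns. -/
noncomputable def gsVec {n : ℕ} (M : Matrix (Fin n) (Fin n) ℝ) (i : Fin n) :
    EuclideanSpace ℝ (Fin n) :=
  InnerProductSpace.gramSchmidt ℝ (basisVec M) i

/-- The coefficient `⟨v, b_j*⟩ / ‖b_j*‖²`. -/
noncomputable def gsCoeff {n : ℕ} (M : Matrix (Fin n) (Fin n) ℝ)
    (v : EuclideanSpace ℝ (Fin n)) (j : Fin n) : ℝ :=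
  inner ℝ v (gsVec M j) / ‖gsVec M j‖ ^ 2

/-- The columns of `M` form an LLL-reduced basis (with the standard parameter `3/4`):
they are linearly independent, size-reduced, and satisfy the Lovász condition. -/
structure IsLLLReduced {n : ℕ} (M : Matrix (Fin n) (Fin n) ℝ) : Prop where
  fullRank : IsUnit M.det
  sizeReduced : ∀ i j : Fin n, j < i → |gsCoeff M (basisVec M i) j| ≤ 1 / 2
  lovasz : ∀ i j : Fin n, (i : ℕ) + 1 = (j : ℕ) →
    (3 / 4 - gsCoeff M (basisVec M j) i ^ 2) * ‖gsVec M i‖ ^ 2 ≤ ‖gsVec M j‖ ^ 2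

/-- The columns of `M'` form an LLL-reduced basis of the lattice generated by the columns of `M`:
`M' = M U` with `U` unimodular. -/
def IsLLLReductionOf {n : ℕ} (M' M : Matrix (Fin n) (Fin n) ℝ) : Prop :=
  IsLLLReduced M' ∧
    ∃ U : Matrix (Fin n) (Fin n) ℤ, IsUnit U.det ∧ M' = M * U.map (fun a : ℤ => (a : ℝ))

/-- Babai's rounding stage (zero-forcing in the basis `M`): each coordinate of `M⁻¹ t`
is rounded to a nearest integer. -/
def IsRounding {n : ℕ} (M : Matrix (Fin n) (Fin n) ℝ) (t : EuclideanSpace ℝ (Fin n))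
    (z : Fin n → ℤ) : Prop :=
  ∀ i, |(M⁻¹).toEuclideanLin t i - (z i : ℝ)| ≤ 1 / 2

/-- Babai's nearest plane stage (successive interference cancellation in the basis `M`):
from the last coordinate to the first, the contribution of the already decided coordinates is
subtracted from the target and the coefficient along `b_i*` is rounded to a nearest integer. -/
def IsNearestPlane {n : ℕ} (M : Matrix (Fin n) (Fin n) ℝ) (t : EuclideanSpace ℝ (Fin n))
    (z : Fin n → ℤ) : Prop :=
  ∀ i, |gsCoeff M (t - ∑ j ∈ Finset.Ioi i, (z j : ℝ) • basisVec M j) i - (z i : ℝ)| ≤ 1 / 2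

/-- `D` is an LLL-based lattice-reduction-aided decoder with decoding stage `stage`, for the
lattice `φ G ℤⁿ` and the regularization matrix `S`: given `y` and `H`, it takes a feedback filter
`B`, an LLL-reduced basis `M` of the lattice generated by `B G`, applies the decoding stage to the
target `F y` in the basis `φ M`, which yields integer coordinates `z`, and returns the
corresponding point `x̂` of `φ G ℤⁿ`, that is, the point with `B x̂ = φ M z`. -/
def IsLRAidedDecoder {m n : ℕ}
    (stage : Matrix (Fin n) (Fin n) ℝ → EuclideanSpace ℝ (Fin n) → (Fin n → ℤ) → Prop)
    (G : Matrix (Fin n) (Fin n) ℝ) (φ : ℝ) (S : Matrix (Fin n) (Fin n) ℝ)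
    (D : Decoder m n) : Prop :=
  ∀ y H, ∃ (B M : Matrix (Fin n) (Fin n) ℝ) (z : Fin n → ℤ),
    IsFeedbackFilter S H B ∧ IsLLLReductionOf M (B * G) ∧
    stage (φ • M) ((forwardFilter H B).toEuclideanLin y) z ∧
    D y H = (B⁻¹).toEuclideanLin (intComb (φ • M) z)

/-- LLL-based LR-aided linear decoder. -/
def IsLRAidedLinear {m n : ℕ} (L : LatticeDesign n) (T r ρ : ℝ)
    (S : Matrix (Fin n) (Fin n) ℝ) (D : Decoder m n) : Prop :=
  IsLRAidedDecoder IsRounding L.G (scaling n T r ρ) S D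

/-- LLL-based LR-aided SIC decoder. -/
def IsLRAidedSIC {m n : ℕ} (L : LatticeDesign n) (T r ρ : ℝ)
    (S : Matrix (Fin n) (Fin n) ℝ) (D : Decoder m n) : Prop :=
  IsLRAidedDecoder IsNearestPlane L.G (scaling n T r ρ) S D

end LatticeDMT

namespace LatticeDMT

/-! ### Gram-Schmidt orthogonalization -/

section GramSchmidt

open InnerProductSpace

variable {E : Type*} [NormedAddCommGroup E] [InnerProductSpace ℝ E] {n : ℕ}

/-! Completing the square (`regMetric_eq`) writes the regularized metric as `‖F y - B x‖ ^ 2` plus a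
nonnegative term independent of `x`, so regularized decoding is a closest vector problem in the
lattice generated by `φ B G`. In an LLL-reduced basis both of Babai's stages solve this problem
within a factor depending only on `n` (`IsLLLReduced.norm_sq_sub_le_of_isNearestPlane`,
`IsLLLReduced.norm_sub_le_of_isRounding`). Adding the nonnegative term to both sides preserves a
factor at least one. Reduced bases exist by a potential argument (`exists_isLLLReductionOf`).

DMT optimality uses only the constant factor (`hasDiversity_of_isApproxDecoder`). If the decoder
errs while `‖w‖ ≤ R` with `R ≥ 1`, then `d = x̂ - x` is a nonzero lattice vector with `‖d‖` and `‖H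
d‖` of order at most `R`, because `S` is positive definite and the codebook is bounded
(`exists_errorProb_le`). Take `R = ρ ^ ε`. Shrinking `d` by `ρ ^ (-2ε)` gives a vector of the scaled
lattice of a slightly larger rate `r'`, and both norms now tend to zero (`shortVectorEvent_subset`).
Such a vector makes every measurable decoder at rate `r'` fail with probability bounded below, since
many pairs of codewords become nearly indistinguishable (`exists_mul_measure_shortVectorEvent_le`).
Hence the error probability at `r` is at most a constant times the ML error probability at `r'`,
plus a Gaussian tail smaller than any power of `ρ` (`exists_stdGaussian_tail_le`). Letting `r'`
decrease to `r`, right continuity gives one inequality; the other is the optimality of ML decoding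
(`IsMLDecoder.errorProb_le`). -/

lemma sub_gramSchmidt_mem_span (f : Fin n → E) (i : Fin n) :
    f i - gramSchmidt ℝ f i ∈ Submodule.span ℝ (f '' Set.Iio i) := by
  rw [← span_gramSchmidt_Iio ℝ f i, gramSchmidt_def, sub_sub_cancel]
  refine Submodule.sum_mem _ fun j hj => ?_
  rw [Submodule.starProjection_singleton]
  exact Submodule.smul_mem _ _ (Submodule.subset_span ⟨j, Finset.mem_Iio.1 hj, rfl⟩)

lemma inner_gramSchmidt_of_mem_span (f : Fin n → E) (i : Fin n) {s : E}
    (hs : s ∈ Submodule.span ℝ (f '' Set.Iio i)) : inner ℝ s (gramSchmidt ℝ f i) = 0 := by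
  induction hs using Submodule.span_induction with
  | mem x hx =>
    obtain ⟨j, hj, rfl⟩ := hx
    rw [real_inner_comm]
    exact gramSchmidt_inv_triangular ℝ f hj
  | zero => simp
  | add x y _ _ hx hy => simp [inner_add_left, hx, hy]
  | smul a x _ hx => simp [inner_smul_left, hx]

/-- Pythagoras: the Gram-Schmidt vector is the component of `f i` orthogonal to the earlier span,
hence the shortest element of its coset. -/
lemma norm_gramSchmidt_le (f : Fin n → E) (i : Fin n) {w : E}
    (hw : f i - w ∈ Submodule.span ℝ (f '' Set.Iio i)) : ‖gramSchmidt ℝ f i‖ ≤ ‖w‖ := by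
  have h1 : w - gramSchmidt ℝ f i ∈ Submodule.span ℝ (f '' Set.Iio i) := by
    have := Submodule.sub_mem _ (sub_gramSchmidt_mem_span f i) hw
    simpa using this
  have h2 := inner_gramSchmidt_of_mem_span f i h1
  have h3 := norm_add_sq_real (w - gramSchmidt ℝ f i) (gramSchmidt ℝ f i)
  rw [h2, sub_add_cancel] at h3
  refine le_of_sq_le_sq ?_ (norm_nonneg _)
  nlinarith [sq_nonneg ‖w - gramSchmidt ℝ f i‖]

/-- Uniqueness of the orthogonal decomposition. It identifies Gram-Schmidt vectors after size
reduction, a column swap or a rescaling without unfolding the recursion. -/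
lemma gramSchmidt_eq_of_sub_mem_span (f : Fin n → E) (i : Fin n) {v : E}
    (hv : f i - v ∈ Submodule.span ℝ (f '' Set.Iio i)) (ho : ∀ j < i, inner ℝ (f j) v = 0) :
    gramSchmidt ℝ f i = v := by
  have h1 : v - gramSchmidt ℝ f i ∈ Submodule.span ℝ (f '' Set.Iio i) := by
    have := Submodule.sub_mem _ (sub_gramSchmidt_mem_span f i) hv
    simpa using this
  have h2 : ∀ s ∈ Submodule.span ℝ (f '' Set.Iio i), inner ℝ s v = 0 := by
    intro s hs
    induction hs using Submodule.span_induction with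
    | mem x hx => obtain ⟨j, hj, rfl⟩ := hx; exact ho j hj
    | zero => simp
    | add x y _ _ hx hy => simp [inner_add_left, hx, hy]
    | smul a x _ hx => simp [inner_smul_left, hx]
  have h3 : inner ℝ (v - gramSchmidt ℝ f i) (v - gramSchmidt ℝ f i) = 0 := by
    rw [inner_sub_right, h2 _ h1, inner_gramSchmidt_of_mem_span f i h1, sub_zero]
  exact (sub_eq_zero.1 (inner_self_eq_zero.1 h3)).symm

end GramSchmidt

section GramSchmidtMatrix

open InnerProductSpace

variable {n : ℕ} {M : Matrix (Fin n) (Fin n) ℝ}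

lemma intComb_eq_sum (M : Matrix (Fin n) (Fin n) ℝ) (z : Fin n → ℤ) :
    intComb M z = ∑ j, (z j : ℝ) • basisVec M j := by
  ext i
  simp [intComb, basisVec, Matrix.toLpLin_apply, Matrix.mulVec, dotProduct, mul_comm]

lemma toEuclideanLin_eq_sum (M : Matrix (Fin n) (Fin n) ℝ) (e : EuclideanSpace ℝ (Fin n)) :
    M.toEuclideanLin e = ∑ j, e j • basisVec M j := by
  ext i
  simp [basisVec, Matrix.toLpLin_apply, Matrix.mulVec, dotProduct, mul_comm]

lemma linearIndependent_basisVec (hM : IsUnit M.det) : LinearIndependent ℝ (basisVec M) := by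
  have h := Matrix.linearIndependent_cols_iff_isUnit.2 ((Matrix.isUnit_iff_isUnit_det M).2 hM)
  exact h.map' (WithLp.linearEquiv 2 ℝ (Fin n → ℝ)).symm.toLinearMap
    (LinearMap.ker_eq_bot.2 (WithLp.linearEquiv 2 ℝ (Fin n → ℝ)).symm.injective)

lemma gsVec_ne_zero (hM : IsUnit M.det) (i : Fin n) : gsVec M i ≠ 0 :=
  gramSchmidt_ne_zero i (linearIndependent_basisVec hM)

lemma gsVec_norm_sq_pos (hM : IsUnit M.det) (i : Fin n) : 0 < ‖gsVec M i‖ ^ 2 :=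
  pow_pos (norm_pos_iff.2 (gsVec_ne_zero hM i)) 2

@[simp] lemma gsCoeff_sub (M : Matrix (Fin n) (Fin n) ℝ) (u v : EuclideanSpace ℝ (Fin n))
    (j : Fin n) : gsCoeff M (u - v) j = gsCoeff M u j - gsCoeff M v j := by
  simp [gsCoeff, inner_sub_left, sub_div]

@[simp] lemma gsCoeff_add (M : Matrix (Fin n) (Fin n) ℝ) (u v : EuclideanSpace ℝ (Fin n))
    (j : Fin n) : gsCoeff M (u + v) j = gsCoeff M u j + gsCoeff M v j := by
  simp [gsCoeff, inner_add_left, add_div]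

@[simp] lemma gsCoeff_smul (M : Matrix (Fin n) (Fin n) ℝ) (a : ℝ) (v : EuclideanSpace ℝ (Fin n))
    (j : Fin n) : gsCoeff M (a • v) j = a * gsCoeff M v j := by
  simp [gsCoeff, inner_smul_left, mul_div_assoc]

lemma gsCoeff_sum {ι : Type*} (M : Matrix (Fin n) (Fin n) ℝ) (s : Finset ι)
    (v : ι → EuclideanSpace ℝ (Fin n)) (j : Fin n) :
    gsCoeff M (∑ i ∈ s, v i) j = ∑ i ∈ s, gsCoeff M (v i) j := by
  simp [gsCoeff, sum_inner, Finset.sum_div]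

lemma gsCoeff_gsVec_of_ne (M : Matrix (Fin n) (Fin n) ℝ) {i j : Fin n} (h : i ≠ j) :
    gsCoeff M (gsVec M i) j = 0 := by
  simp [gsCoeff, gsVec, gramSchmidt_orthogonal ℝ _ h]

lemma gsCoeff_gsVec_self (hM : IsUnit M.det) (i : Fin n) : gsCoeff M (gsVec M i) i = 1 := by
  rw [gsCoeff, real_inner_self_eq_norm_sq, div_self (gsVec_norm_sq_pos hM i).ne']

lemma gsCoeff_basisVec_of_lt (M : Matrix (Fin n) (Fin n) ℝ) {i j : Fin n} (h : i < j) :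
    gsCoeff M (basisVec M i) j = 0 := by
  rw [gsCoeff, real_inner_comm, gsVec, gramSchmidt_inv_triangular ℝ _ h, zero_div]

lemma basisVec_eq_gsVec_add (M : Matrix (Fin n) (Fin n) ℝ) (i : Fin n) :
    basisVec M i = gsVec M i + ∑ j ∈ Finset.Iio i, gsCoeff M (basisVec M i) j • gsVec M j := by
  have := gramSchmidt_def'' ℝ (basisVec M) i
  simp only [gsCoeff, gsVec, real_inner_comm (gramSchmidt ℝ (basisVec M) _)] at this ⊢
  exact this

lemma gsCoeff_basisVec_self (hM : IsUnit M.det) (i : Fin n) :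
    gsCoeff M (basisVec M i) i = 1 := by
  rw [basisVec_eq_gsVec_add, gsCoeff_add, gsCoeff_gsVec_self hM, gsCoeff_sum,
    Finset.sum_eq_zero, add_zero]
  intro j hj
  rw [gsCoeff_smul, gsCoeff_gsVec_of_ne M (Finset.mem_Iio.1 hj).ne, mul_zero]

lemma eq_sum_gsCoeff (hM : IsUnit M.det) (t : EuclideanSpace ℝ (Fin n)) :
    t = ∑ j, gsCoeff M t j • gsVec M j := by
  have hspan : Submodule.span ℝ (Set.range (gsVec M)) = ⊤ := by
    have h := span_gramSchmidt ℝ (basisVec M)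
    have h2 := (linearIndependent_basisVec hM).span_eq_top_of_card_eq_finrank' (by simp)
    exact h.trans h2
  have horth : ∀ s ∈ Submodule.span ℝ (Set.range (gsVec M)),
      inner ℝ s (t - ∑ j, gsCoeff M t j • gsVec M j) = 0 := by
    intro s hs
    induction hs using Submodule.span_induction with
    | mem x hx =>
      obtain ⟨i, rfl⟩ := hx
      rw [inner_sub_right, inner_sum, Finset.sum_eq_single i]
      · rw [inner_smul_right, real_inner_self_eq_norm_sq, gsCoeff,
          div_mul_cancel₀ _ (gsVec_norm_sq_pos hM i).ne', real_inner_comm, sub_self]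
      · intro j _ hj
        rw [inner_smul_right, gsVec, gsVec, gramSchmidt_orthogonal ℝ _ hj.symm, mul_zero]
      · simp
    | zero => simp
    | add x y _ _ hx hy => simp [inner_add_left, hx, hy]
    | smul a x _ hx => simp [inner_smul_left, hx]
  rw [hspan] at horth
  exact sub_eq_zero.1 (inner_self_eq_zero.1 (horth _ Submodule.mem_top))

lemma norm_sq_eq_sum_gsCoeff (hM : IsUnit M.det) (t : EuclideanSpace ℝ (Fin n)) :
    ‖t‖ ^ 2 = ∑ j, gsCoeff M t j ^ 2 * ‖gsVec M j‖ ^ 2 := by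
  have h : inner ℝ t t = ∑ j, gsCoeff M t j ^ 2 * ‖gsVec M j‖ ^ 2 := by
    nth_rw 2 [eq_sum_gsCoeff hM t]
    rw [inner_sum]
    refine Finset.sum_congr rfl fun j _ => ?_
    have := (gsVec_norm_sq_pos hM j).ne'
    rw [inner_smul_right, gsCoeff]
    field_simp
  rw [← h, real_inner_self_eq_norm_sq]

/-- Column `i` contributes exactly `z i` to the coefficient along `b_i*` and earlier columns
contribute nothing, so the successive rounding conditions say that the final residual lies in the
box spanned by the halved Gram-Schmidt vectors. -/
lemma isNearestPlane_iff (hM : IsUnit M.det) (t : EuclideanSpace ℝ (Fin n)) (z : Fin n → ℤ) :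
    IsNearestPlane M t z ↔ ∀ i, |gsCoeff M (t - intComb M z) i| ≤ 1 / 2 := by
  refine forall_congr' fun i => ?_
  have h : gsCoeff M (intComb M z) i =
      gsCoeff M (∑ j ∈ Finset.Ioi i, (z j : ℝ) • basisVec M j) i + z i := by
    rw [intComb_eq_sum, gsCoeff_sum, gsCoeff_sum,
      ← Finset.sum_subset (Finset.subset_univ (Finset.Ici i)), ← Finset.Ioi_insert,
      Finset.sum_insert (by simp), gsCoeff_smul, gsCoeff_basisVec_self hM, mul_one, add_comm]
    intro j _ hj
    rw [gsCoeff_smul, gsCoeff_basisVec_of_lt M (by simpa using hj), mul_zero]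
  rw [gsCoeff_sub, gsCoeff_sub, h, ← sub_sub]

lemma gsCoeff_intComb (hM : IsUnit M.det) {d : Fin n → ℤ} {i : Fin n}
    (hd : ∀ l, i < l → d l = 0) : gsCoeff M (intComb M d) i = d i := by
  rw [intComb_eq_sum, gsCoeff_sum, Finset.sum_eq_single i]
  · rw [gsCoeff_smul, gsCoeff_basisVec_self hM, mul_one]
  · intro l _ hl
    rcases hl.lt_or_gt with h | h
    · rw [gsCoeff_smul, gsCoeff_basisVec_of_lt M h, mul_zero]
    · simp [hd l h, gsCoeff]
  · simp

/-- Babai's nearest plane procedure on the first `k` basis vectors. -/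
lemma exists_intComb_gsCoeff_le (hM : IsUnit M.det) (k : ℕ) (t : EuclideanSpace ℝ (Fin n)) :
    ∃ z : Fin n → ℤ, (∀ j : Fin n, k ≤ j → z j = 0) ∧
      ∀ j : Fin n, (j : ℕ) < k → |gsCoeff M (t - intComb M z) j| ≤ 1 / 2 := by
  induction k generalizing t with
  | zero => exact ⟨0, by simp, by simp⟩
  | succ k ih =>
    by_cases hk : k < n
    · set i : Fin n := ⟨k, hk⟩
      -- The last coordinate is fixed first. The recursive choice involves only earlier columns,
      -- which leave the coefficient along `b_i*` unchanged.
      set a : ℤ := round (gsCoeff M t i)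
      obtain ⟨z, hz0, hz⟩ := ih (t - (a : ℝ) • basisVec M i)
      refine ⟨fun j => z j + if j = i then a else 0, fun j hj => ?_, fun j hj => ?_⟩
      · have : j ≠ i := fun h => by subst h; simp [i] at hj
        simp [this, hz0 j (by omega)]
      · have hadd : intComb M (fun j => z j + if j = i then a else 0) =
            intComb M z + (a : ℝ) • basisVec M i := by
          simp [intComb_eq_sum, add_smul, Finset.sum_add_distrib]
        rw [hadd, ← sub_sub, sub_right_comm]
        rcases (Nat.lt_succ_iff.1 hj).lt_or_eq with h | h
        · exact hz j h
        · have hji : j = i := Fin.ext h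
          have h0 : gsCoeff M (intComb M z) j = 0 := by
            rw [gsCoeff_intComb hM fun l hl => hz0 l (by omega), hz0 j h.ge, Int.cast_zero]
          rw [gsCoeff_sub, h0, sub_zero, hji, gsCoeff_sub, gsCoeff_smul,
            gsCoeff_basisVec_self hM, mul_one]
          exact abs_sub_round _
    · obtain ⟨z, hz0, hz⟩ := ih t
      exact ⟨z, fun j hj => hz0 j (by omega), fun j hj => hz j (by omega)⟩

end GramSchmidtMatrix

/-! ### Babai's decoding stages in an LLL-reduced basis -/

section Babai

variable {n : ℕ} {M : Matrix (Fin n) (Fin n) ℝ}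

lemma sum_range_two_pow_sub (K : ℕ) :
    ∑ i ∈ Finset.range (K + 1), (2 : ℝ) ^ (K - i) = 2 ^ (K + 1) - 1 := by
  induction K with
  | zero => norm_num
  | succ K ih =>
    rw [Finset.sum_range_succ']
    simp only [Nat.add_sub_add_right, Nat.sub_zero]
    rw [ih]
    ring

lemma sum_Iic_two_pow_sub (k : Fin n) :
    ∑ i ∈ Finset.Iic k, (2 : ℝ) ^ ((k : ℕ) - i) = 2 ^ ((k : ℕ) + 1) - 1 := by
  have h := Finset.sum_map (Finset.Iic k) Fin.valEmbedding fun i => (2 : ℝ) ^ ((k : ℕ) - i)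
  rw [Fin.map_valEmbedding_Iic, ← Nat.range_succ_eq_Iic, sum_range_two_pow_sub] at h
  exact h.symm

lemma sum_Ioi_three_halves_pow (j : Fin n) :
    ∑ i ∈ Finset.Ioi j, (3 / 2 : ℝ) ^ (n - 1 - i) = 2 * ((3 / 2) ^ (n - 1 - j) - 1) := by
  have h := Finset.sum_map (Finset.Ioi j) Fin.valEmbedding fun i => (3 / 2 : ℝ) ^ (n - 1 - i)
  rw [Fin.map_valEmbedding_Ioi] at h
  have h2 : Finset.Ioo (j : ℕ) n = Finset.Ico ((j : ℕ) + 1) n := rfl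
  rw [h2, Finset.sum_Ico_eq_sum_range] at h
  have h3 : ∑ i ∈ Finset.range (n - (j + 1)), (3 / 2 : ℝ) ^ (n - 1 - (j + 1 + i)) =
      ∑ i ∈ Finset.range (n - (j + 1)), (3 / 2 : ℝ) ^ (n - (j + 1) - 1 - i) :=
    Finset.sum_congr rfl fun i hi => by congr 1; omega
  rw [h3, Finset.sum_range_reflect (fun i => (3 / 2 : ℝ) ^ i), geom_sum_eq (by norm_num)] at h
  have h4 : n - ((j : ℕ) + 1) = n - 1 - j := by omega
  rw [h4] at h
  refine h.symm.trans ?_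
  ring

/-- With coefficients at most `1/2`, the Lovász condition gives `3/4 - 1/4 = 1/2`: each step to the
next Gram-Schmidt vector at most halves the squared norm. -/
lemma IsLLLReduced.norm_sq_gsVec_le (h : IsLLLReduced M) {i j : Fin n} (hij : i ≤ j) :
    ‖gsVec M i‖ ^ 2 ≤ 2 ^ ((j : ℕ) - i) * ‖gsVec M j‖ ^ 2 := by
  obtain ⟨d, hd⟩ : ∃ d : ℕ, (j : ℕ) = i + d := Nat.exists_eq_add_of_le hij
  induction d generalizing j with
  | zero => rw [Fin.ext (a := j) (b := i) (by simpa using hd)]; simp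
  | succ d ih =>
    have hlt : (i : ℕ) + d < n := by omega
    have h1 := ih (j := ⟨i + d, hlt⟩) (Fin.le_def.2 (by simp)) rfl
    have h2 := h.lovasz ⟨i + d, hlt⟩ j (by simp [hd]; omega)
    have h3 : gsCoeff M (basisVec M j) ⟨i + d, hlt⟩ ^ 2 ≤ (1 / 2) ^ 2 :=
      sq_le_sq' (abs_le.1 (h.sizeReduced j ⟨i + d, hlt⟩ (Fin.lt_def.2 (by simp [hd])))).1
        (abs_le.1 (h.sizeReduced j ⟨i + d, hlt⟩ (Fin.lt_def.2 (by simp [hd])))).2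
    have h4 : ‖gsVec M ⟨i + d, hlt⟩‖ ^ 2 ≤ 2 * ‖gsVec M j‖ ^ 2 := by
      nlinarith [sq_nonneg ‖gsVec M ⟨i + d, hlt⟩‖]
    calc ‖gsVec M i‖ ^ 2 ≤ 2 ^ d * ‖gsVec M ⟨i + d, hlt⟩‖ ^ 2 := by simpa using h1
      _ ≤ 2 ^ d * (2 * ‖gsVec M j‖ ^ 2) := by gcongr
      _ = 2 ^ ((j : ℕ) - i) * ‖gsVec M j‖ ^ 2 := by
        rw [hd, Nat.add_sub_cancel_left, pow_succ]; ring

/-- The nearest plane procedure in an LLL-reduced basis is within the factor `2 ^ (n / 2)` of the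
distance of the target to the lattice. -/
lemma IsLLLReduced.norm_sq_sub_le_of_isNearestPlane (h : IsLLLReduced M)
    {t : EuclideanSpace ℝ (Fin n)} {z : Fin n → ℤ} (hz : IsNearestPlane M t z)
    (z' : Fin n → ℤ) :
    ‖t - intComb M z‖ ^ 2 ≤ 2 ^ n * ‖t - intComb M z'‖ ^ 2 := by
  have hM := h.fullRank
  rw [isNearestPlane_iff hM] at hz
  by_cases hzz : z = z'
  · subst hzz
    exact le_mul_of_one_le_left (sq_nonneg _) (one_le_pow₀ (by norm_num))
  -- `k` is the last coordinate where `z` and `z'` differ. Beyond `k` the two residuals have equal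
  -- coefficients. At `k` they differ by a nonzero integer, so the one for `z'` has size at least
  -- `1/2`. By the bound on Gram-Schmidt norms, that single term pays for all terms of the residual
  -- of `z` up to `k`.
  obtain ⟨k, hk⟩ : ∃ k, z k ≠ z' k ∧ ∀ i, k < i → z i = z' i := by
    have hne : (Finset.univ.filter fun i => z i ≠ z' i).Nonempty := by
      obtain ⟨i, hi⟩ := Function.ne_iff.1 hzz
      exact ⟨i, by simpa using hi⟩
    refine ⟨Finset.max' _ hne, by simpa using Finset.max'_mem _ hne, fun i hi => ?_⟩
    by_contra hcon
    exact absurd (Finset.le_max' _ i (by simpa using hcon)) (not_le.2 hi)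
  set c := gsCoeff M (t - intComb M z) with hc
  set c' := gsCoeff M (t - intComb M z') with hc'
  have hdiff : ∀ i, k ≤ i → c' i = c i + ((z i : ℝ) - z' i) := by
    intro i hi
    have h1 : t - intComb M z' = (t - intComb M z) + intComb M (z - z') := by
      simp [intComb_eq_sum, sub_smul, Finset.sum_sub_distrib]
    rw [hc', h1, gsCoeff_add, gsCoeff_intComb hM fun l hl => ?_]
    · simp [hc]
    · simp [hk.2 l (hi.trans_lt hl)]
  have hck : 1 / 4 ≤ c' k ^ 2 := by
    have h1 : (1 : ℝ) ≤ |(z k : ℝ) - z' k| := by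
      exact_mod_cast Int.one_le_abs (sub_ne_zero.2 hk.1)
    have h2 : 1 / 2 ≤ |c' k| := by
      rw [hdiff k le_rfl]
      have := abs_sub_abs_le_abs_sub ((z k : ℝ) - z' k) (-c k)
      rw [abs_neg, sub_neg_eq_add, add_comm] at this
      linarith [hz k]
    rw [← sq_abs]
    nlinarith
  have hlow : ∑ i ∈ Finset.Iic k, c i ^ 2 * ‖gsVec M i‖ ^ 2 ≤
      2 ^ n * (c' k ^ 2 * ‖gsVec M k‖ ^ 2) := by
    calc ∑ i ∈ Finset.Iic k, c i ^ 2 * ‖gsVec M i‖ ^ 2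
        ≤ ∑ i ∈ Finset.Iic k, 2 ^ ((k : ℕ) - i) * (c' k ^ 2 * ‖gsVec M k‖ ^ 2) := by
          refine Finset.sum_le_sum fun i hi => ?_
          have h1 := h.norm_sq_gsVec_le (Finset.mem_Iic.1 hi)
          have h2 : c i ^ 2 ≤ c' k ^ 2 := by
            refine le_trans ?_ hck
            rw [← sq_abs]
            nlinarith [hz i, abs_nonneg (c i)]
          calc c i ^ 2 * ‖gsVec M i‖ ^ 2
              ≤ c' k ^ 2 * (2 ^ ((k : ℕ) - i) * ‖gsVec M k‖ ^ 2) := by gcongr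
            _ = _ := by ring
      _ = (2 ^ ((k : ℕ) + 1) - 1) * (c' k ^ 2 * ‖gsVec M k‖ ^ 2) := by
          rw [← Finset.sum_mul, sum_Iic_two_pow_sub]
      _ ≤ 2 ^ n * (c' k ^ 2 * ‖gsVec M k‖ ^ 2) := by
          gcongr
          have : (2 : ℝ) ^ ((k : ℕ) + 1) ≤ 2 ^ n := pow_le_pow_right₀ (by norm_num) k.2
          linarith
  have hsplit : ∀ f : Fin n → ℝ, ∑ i, f i = ∑ i ∈ Finset.Iic k, f i + ∑ i ∈ Finset.Ioi k, f i := by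
    intro f
    rw [← Finset.sum_filter_add_sum_filter_not Finset.univ (· ≤ k), Finset.filter_ge_eq_Iic]
    simp only [not_le, Finset.filter_lt_eq_Ioi]
  have hhigh : ∑ i ∈ Finset.Ioi k, c i ^ 2 * ‖gsVec M i‖ ^ 2 ≤
      2 ^ n * ∑ i ∈ Finset.Ioi k, c' i ^ 2 * ‖gsVec M i‖ ^ 2 := by
    have h1 : ∑ i ∈ Finset.Ioi k, c i ^ 2 * ‖gsVec M i‖ ^ 2 =
        ∑ i ∈ Finset.Ioi k, c' i ^ 2 * ‖gsVec M i‖ ^ 2 :=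
      Finset.sum_congr rfl fun i hi => by
        rw [hdiff i (Finset.mem_Ioi.1 hi).le, hk.2 i (Finset.mem_Ioi.1 hi), sub_self, add_zero]
    rw [h1]
    exact le_mul_of_one_le_left (Finset.sum_nonneg fun i _ => by positivity)
      (one_le_pow₀ (by norm_num))
  have hself : c' k ^ 2 * ‖gsVec M k‖ ^ 2 ≤ ∑ i ∈ Finset.Iic k, c' i ^ 2 * ‖gsVec M i‖ ^ 2 :=
    Finset.single_le_sum (f := fun i => c' i ^ 2 * ‖gsVec M i‖ ^ 2)
      (fun i _ => by positivity) (Finset.mem_Iic.2 le_rfl)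
  rw [norm_sq_eq_sum_gsCoeff hM (t - intComb M z), norm_sq_eq_sum_gsCoeff hM (t - intComb M z'),
    hsplit, hsplit, mul_add]
  have := mul_le_mul_of_nonneg_left hself (by positivity : (0 : ℝ) ≤ 2 ^ n)
  linarith

/-- Size reduction bounds each squared off-diagonal coefficient by `1/4`, and the geometric sum
gives the factor `1 + (2 ^ (k + 1) - 2) / 4 ≤ 2 ^ k`. -/
lemma IsLLLReduced.norm_sq_basisVec_le (h : IsLLLReduced M) (k : Fin n) :
    ‖basisVec M k‖ ^ 2 ≤ 2 ^ (k : ℕ) * ‖gsVec M k‖ ^ 2 := by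
  have hM := h.fullRank
  have hterm : ∀ j, gsCoeff M (basisVec M k) j ^ 2 * ‖gsVec M j‖ ^ 2 ≤
      if j ≤ k then
        (if j = k then ‖gsVec M k‖ ^ 2 else 1 / 4 * (2 ^ ((k : ℕ) - j) * ‖gsVec M k‖ ^ 2))
      else 0 := by
    intro j
    split_ifs with h1 h2
    · rw [h2, gsCoeff_basisVec_self hM]; simp
    · have h3 := h.sizeReduced k j (lt_of_le_of_ne h1 h2)
      have h4 : gsCoeff M (basisVec M k) j ^ 2 ≤ 1 / 4 := by
        rw [← sq_abs]
        nlinarith [abs_nonneg (gsCoeff M (basisVec M k) j)]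
      have h5 := h.norm_sq_gsVec_le h1
      gcongr
    · rw [gsCoeff_basisVec_of_lt M (not_le.1 h1)]; simp
  rw [norm_sq_eq_sum_gsCoeff hM]
  refine (Finset.sum_le_sum fun j _ => hterm j).trans ?_
  rw [← Finset.sum_filter, Finset.filter_ge_eq_Iic, ← Finset.Iio_insert,
    Finset.sum_insert (by simp), if_pos rfl]
  have h1 : ∑ j ∈ Finset.Iio k,
      (if j = k then ‖gsVec M k‖ ^ 2 else 1 / 4 * (2 ^ ((k : ℕ) - j) * ‖gsVec M k‖ ^ 2)) =
      1 / 4 * ((∑ j ∈ Finset.Iio k, (2 : ℝ) ^ ((k : ℕ) - j)) * ‖gsVec M k‖ ^ 2) := by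
    rw [Finset.sum_mul, Finset.mul_sum]
    exact Finset.sum_congr rfl fun j hj => if_neg (Finset.mem_Iio.1 hj).ne
  have h2 := sum_Iic_two_pow_sub k
  rw [← Finset.Iio_insert, Finset.sum_insert (by simp), Nat.sub_self, pow_zero] at h2
  have h3 : ∑ j ∈ Finset.Iio k, (2 : ℝ) ^ ((k : ℕ) - j) = 2 * 2 ^ (k : ℕ) - 2 := by
    rw [pow_succ] at h2; linarith
  rw [h1, h3]
  have h4 : (1 : ℝ) ≤ 2 ^ (k : ℕ) := one_le_pow₀ (by norm_num)
  nlinarith [sq_nonneg ‖gsVec M k‖]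

lemma gsCoeff_toEuclideanLin (hM : IsUnit M.det) (β : EuclideanSpace ℝ (Fin n)) (j : Fin n) :
    gsCoeff M (M.toEuclideanLin β) j =
      β j + ∑ i ∈ Finset.Ioi j, β i * gsCoeff M (basisVec M i) j := by
  rw [toEuclideanLin_eq_sum, gsCoeff_sum, ← Finset.sum_subset (Finset.subset_univ (Finset.Ici j)),
    ← Finset.Ioi_insert, Finset.sum_insert (by simp), gsCoeff_smul, gsCoeff_basisVec_self hM,
    mul_one]
  · simp
  · intro i _ hi
    rw [gsCoeff_smul, gsCoeff_basisVec_of_lt M (by simpa using hi), mul_zero]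

/-- Back substitution in a unit triangular system with off-diagonal entries at most `1/2`. If all
coefficients from `k` on were below `ε`, each step back would enlarge the bound on `β` by at most
`3/2`, giving `|β k| < |β k|`. -/
lemma IsLLLReduced.exists_le_abs_gsCoeff (h : IsLLLReduced M) (β : EuclideanSpace ℝ (Fin n))
    (k : Fin n) : ∃ j, k ≤ j ∧
      (2 / 3) ^ (n - 1 - k) * |β k| ≤ |gsCoeff M (M.toEuclideanLin β) j| := by
  by_contra! hcon
  set ε : ℝ := (2 / 3) ^ (n - 1 - k) * |β k|
  have key : ∀ d : ℕ, ∀ j : Fin n, k ≤ j → n - 1 - j = d → |β j| < ε * (3 / 2) ^ (n - 1 - j) := by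
    intro d
    induction d using Nat.strong_induction_on with
    | _ d ih =>
      intro j hkj hj
      have h1 : β j = gsCoeff M (M.toEuclideanLin β) j -
          ∑ i ∈ Finset.Ioi j, β i * gsCoeff M (basisVec M i) j := by
        rw [gsCoeff_toEuclideanLin h.fullRank]; ring
      have h2 : |∑ i ∈ Finset.Ioi j, β i * gsCoeff M (basisVec M i) j| ≤
          ∑ i ∈ Finset.Ioi j, 1 / 2 * (ε * (3 / 2) ^ (n - 1 - i)) := by
        refine (Finset.abs_sum_le_sum_abs _ _).trans (Finset.sum_le_sum fun i hi => ?_)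
        have hi' := Finset.mem_Ioi.1 hi
        have h3 := ih (n - 1 - i) (by have := Fin.lt_def.1 hi'; omega) i (hkj.trans hi'.le) rfl
        have h4 := h.sizeReduced i j hi'
        rw [abs_mul, mul_comm]
        exact mul_le_mul h4 h3.le (abs_nonneg _) (by norm_num)
      rw [← Finset.mul_sum, ← Finset.mul_sum, sum_Ioi_three_halves_pow] at h2
      have h5 := abs_sub (gsCoeff M (M.toEuclideanLin β) j)
        (∑ i ∈ Finset.Ioi j, β i * gsCoeff M (basisVec M i) j)
      rw [← h1] at h5
      have h6 := hcon j hkj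
      nlinarith
  have := key _ k le_rfl rfl
  rw [mul_right_comm, ← mul_pow] at this
  norm_num at this

/-- In an LLL-reduced basis, every basis vector makes an angle bounded away from zero with the span
of the others. -/
lemma IsLLLReduced.sq_mul_norm_sq_basisVec_le (h : IsLLLReduced M)
    (β : EuclideanSpace ℝ (Fin n)) (k : Fin n) :
    β k ^ 2 * ‖basisVec M k‖ ^ 2 ≤ (9 / 2) ^ n * ‖M.toEuclideanLin β‖ ^ 2 := by
  obtain ⟨j, hkj, hj⟩ := h.exists_le_abs_gsCoeff β k
  set N := n - 1 - (k : ℕ) with hN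
  have h1 : gsCoeff M (M.toEuclideanLin β) j ^ 2 * ‖gsVec M j‖ ^ 2 ≤ ‖M.toEuclideanLin β‖ ^ 2 := by
    rw [norm_sq_eq_sum_gsCoeff h.fullRank (M.toEuclideanLin β)]
    exact Finset.single_le_sum
      (f := fun j => gsCoeff M (M.toEuclideanLin β) j ^ 2 * ‖gsVec M j‖ ^ 2)
      (fun i _ => by positivity) (Finset.mem_univ j)
  have h2 : (4 / 9) ^ N * β k ^ 2 ≤ gsCoeff M (M.toEuclideanLin β) j ^ 2 := by
    rw [← sq_abs (β k), ← sq_abs (gsCoeff _ _ _)]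
    calc (4 / 9 : ℝ) ^ N * |β k| ^ 2 = ((2 / 3) ^ N * |β k|) ^ 2 := by
          rw [mul_pow, ← pow_mul, mul_comm N, pow_mul]; norm_num
      _ ≤ _ := by gcongr
  have h3 : ‖gsVec M k‖ ^ 2 ≤ 2 ^ N * ‖gsVec M j‖ ^ 2 := by
    refine (h.norm_sq_gsVec_le hkj).trans ?_
    gcongr
    · norm_num
    · omega
  have h4 := h.norm_sq_basisVec_le k
  -- The base `9/2` is `9/4`, lost squared in back substitution, times `2`, lost in the decay of
  -- Gram-Schmidt norms from `k` to `j`.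
  calc β k ^ 2 * ‖basisVec M k‖ ^ 2
      ≤ β k ^ 2 * (2 ^ (k : ℕ) * (2 ^ N * ‖gsVec M j‖ ^ 2)) := by
        gcongr
        exact h4.trans (by gcongr)
    _ = (9 / 4) ^ N * (2 ^ N * 2 ^ (k : ℕ)) * (((4 / 9) ^ N * β k ^ 2) * ‖gsVec M j‖ ^ 2) := by
        have : (9 / 4 : ℝ) ^ N * (4 / 9) ^ N = 1 := by rw [← mul_pow]; norm_num
        linear_combination (-(β k ^ 2 * (2 ^ (k : ℕ) * (2 ^ N * ‖gsVec M j‖ ^ 2)))) * this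
    _ ≤ (9 / 2) ^ n * ‖M.toEuclideanLin β‖ ^ 2 := by
        gcongr
        · rw [← mul_assoc, ← mul_pow]
          calc ((9 / 4 * 2 : ℝ)) ^ N * 2 ^ (k : ℕ) ≤ (9 / 2) ^ N * (9 / 2) ^ (k : ℕ) := by
                norm_num
                gcongr
                norm_num
            _ = (9 / 2) ^ (N + k) := by rw [pow_add]
            _ ≤ (9 / 2) ^ n := pow_le_pow_right₀ (by norm_num) (by omega)
        · exact le_trans (by gcongr) h1

/-- Babai rounding in an LLL-reduced basis is within the factor `1 + 2 n (9 / 2) ^ (n / 2)` of the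
distance of the target to the lattice. -/
lemma IsLLLReduced.norm_sub_le_of_isRounding (h : IsLLLReduced M)
    {t : EuclideanSpace ℝ (Fin n)} {z : Fin n → ℤ} (hz : IsRounding M t z)
    (z' : Fin n → ℤ) :
    ‖t - intComb M z‖ ≤ (1 + 2 * n * (9 / 2 : ℝ) ^ ((n : ℝ) / 2)) * ‖t - intComb M z'‖ := by
  set K : ℝ := (9 / 2 : ℝ) ^ ((n : ℝ) / 2) with hK
  have hK0 : 0 ≤ K := by positivity
  have hK2 : K ^ 2 = (9 / 2) ^ n := by
    rw [hK, ← Real.rpow_natCast, ← Real.rpow_mul (by norm_num)]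
    simp
  -- `β` holds the coordinates of `t - M z'` in the basis `M`. Where `z` and `z'` differ, their
  -- distance is at least `1` and at most `1/2 + |β k|`, hence at most `2 |β k|`; this is the source
  -- of the factor `2` in the constant.
  set β : EuclideanSpace ℝ (Fin n) :=
    (M⁻¹).toEuclideanLin t - WithLp.toLp 2 (fun i => (z' i : ℝ)) with hβ
  have hMβ : M.toEuclideanLin β = t - intComb M z' := by
    rw [hβ, map_sub]
    congr 1
    rw [← LinearMap.comp_apply, ← Matrix.toLpLin_mul_same, Matrix.mul_nonsing_inv _ h.fullRank]
    simp
  have hb : ∀ k, |(z' k : ℝ) - z k| * ‖basisVec M k‖ ≤ 2 * (K * ‖t - intComb M z'‖) := by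
    intro k
    have h1 : |β k| * ‖basisVec M k‖ ≤ K * ‖t - intComb M z'‖ := by
      refine le_of_sq_le_sq ?_ (by positivity)
      rw [mul_pow, mul_pow, sq_abs, hK2, ← hMβ]
      exact h.sq_mul_norm_sq_basisVec_le β k
    have h2 : |(z' k : ℝ) - z k| ≤ 2 * |β k| := by
      by_cases hzk : z' k = z k
      · simp [hzk]
      · have h3 : (1 : ℝ) ≤ |(z' k : ℝ) - z k| := by
          exact_mod_cast Int.one_le_abs (sub_ne_zero.2 hzk)
        have h4 := hz k
        have h5 : (z' k : ℝ) - z k = ((M⁻¹).toEuclideanLin t k - z k) - β k := by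
          simp [hβ]
        have h6 := abs_sub ((M⁻¹).toEuclideanLin t k - z k) (β k)
        rw [← h5] at h6
        linarith
    calc |(z' k : ℝ) - z k| * ‖basisVec M k‖ ≤ 2 * |β k| * ‖basisVec M k‖ := by gcongr
      _ ≤ _ := by linarith
  have hsum : ‖intComb M z' - intComb M z‖ ≤ n * (2 * (K * ‖t - intComb M z'‖)) := by
    have hd : intComb M z' - intComb M z =
        ∑ k, ((z' k : ℝ) • basisVec M k - (z k : ℝ) • basisVec M k) := by
      rw [intComb_eq_sum, intComb_eq_sum, Finset.sum_sub_distrib]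
    rw [hd]
    refine (norm_sum_le _ _).trans ?_
    calc ∑ k, ‖(z' k : ℝ) • basisVec M k - (z k : ℝ) • basisVec M k‖
        ≤ ∑ _k : Fin n, 2 * (K * ‖t - intComb M z'‖) := by
          refine Finset.sum_le_sum fun k _ => ?_
          rw [← sub_smul, norm_smul, Real.norm_eq_abs]
          exact hb k
      _ = _ := by simp
  have htri := norm_add_le (t - intComb M z') (intComb M z' - intComb M z)
  rw [sub_add_sub_cancel] at htri
  linarith

end Babai

/-! ### Existence of LLL-reduced bases -/

section LLL

open InnerProductSpace

variable {n : ℕ} {M : Matrix (Fin n) (Fin n) ℝ}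

/-- The matrix with real entries underlying an integer matrix. -/
abbrev toRealMatrix (U : Matrix (Fin n) (Fin n) ℤ) : Matrix (Fin n) (Fin n) ℝ :=
  U.map (fun a : ℤ => (a : ℝ))

lemma toRealMatrix_mul (U V : Matrix (Fin n) (Fin n) ℤ) :
    toRealMatrix (U * V) = toRealMatrix U * toRealMatrix V :=
  Matrix.map_mul (f := Int.castRingHom ℝ)

lemma det_toRealMatrix (U : Matrix (Fin n) (Fin n) ℤ) : (toRealMatrix U).det = (U.det : ℝ) :=
  ((Int.castRingHom ℝ).map_det U).symm

lemma isUnit_det_toRealMatrix {U : Matrix (Fin n) (Fin n) ℤ} (hU : IsUnit U.det) :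
    IsUnit (toRealMatrix U).det := by
  rw [det_toRealMatrix]
  exact hU.map (Int.castRingHom ℝ)

lemma isUnit_det_mul_toRealMatrix (hM : IsUnit M.det) {U : Matrix (Fin n) (Fin n) ℤ}
    (hU : IsUnit U.det) : IsUnit (M * toRealMatrix U).det := by
  rw [Matrix.det_mul]
  exact hM.mul (isUnit_det_toRealMatrix hU)

lemma basisVec_mul (A U : Matrix (Fin n) (Fin n) ℝ) (i : Fin n) :
    basisVec (A * U) i = A.toEuclideanLin (basisVec U i) := by
  ext k
  simp [basisVec, Matrix.toLpLin_apply, Matrix.mulVec, dotProduct, Matrix.mul_apply]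

/-- The Gram determinant of the first `k` columns of `M`. -/
noncomputable def leadingGram (M : Matrix (Fin n) (Fin n) ℝ) (k : ℕ) : ℝ :=
  ((M.transpose * M).submatrix (Subtype.val : {i : Fin n // (i : ℕ) < k} → Fin n)
    Subtype.val).det

lemma transpose_mul_self_apply (M : Matrix (Fin n) (Fin n) ℝ) (i j : Fin n) :
    (M.transpose * M) i j = inner ℝ (basisVec M i) (basisVec M j) := by
  simp [basisVec, Matrix.mul_apply, PiLp.inner_apply, mul_comm]

lemma inner_eq_sum_gsCoeff (hM : IsUnit M.det) (s t : EuclideanSpace ℝ (Fin n)) :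
    inner ℝ s t = ∑ j, gsCoeff M s j * ‖gsVec M j‖ ^ 2 * gsCoeff M t j := by
  nth_rw 1 [eq_sum_gsCoeff hM t]
  rw [inner_sum]
  refine Finset.sum_congr rfl fun j _ => ?_
  rw [inner_smul_right, gsCoeff.eq_1 M s, div_mul_cancel₀ _ (gsVec_norm_sq_pos hM j).ne', mul_comm]

/-- The leading block of the Gram matrix factors as `Nᵀ D N`, with `N` the unit upper triangular
matrix of Gram-Schmidt coefficients; triangularity lets the inner sum stop at `k`. -/
lemma leadingGram_eq_prod (hM : IsUnit M.det) (k : ℕ) :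
    leadingGram M k = ∏ i ∈ Finset.univ.filter (fun i : Fin n => (i : ℕ) < k),
      ‖gsVec M i‖ ^ 2 := by
  let N : Matrix {i : Fin n // (i : ℕ) < k} {i : Fin n // (i : ℕ) < k} ℝ :=
    fun l i => gsCoeff M (basisVec M i) l
  have hN : N.det = 1 := by
    have htri : N.BlockTriangular id := fun l i hli => gsCoeff_basisVec_of_lt M hli
    rw [Matrix.det_of_isUpperTriangular htri]
    exact Finset.prod_eq_one fun i _ => gsCoeff_basisVec_self hM i
  have hfac : (M.transpose * M).submatrix (Subtype.val : {i : Fin n // (i : ℕ) < k} → Fin n)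
      Subtype.val = N.transpose *
        Matrix.diagonal (fun i : {i : Fin n // (i : ℕ) < k} => ‖gsVec M i‖ ^ 2) * N := by
    ext i j
    rw [Matrix.submatrix_apply, transpose_mul_self_apply, inner_eq_sum_gsCoeff hM,
      Matrix.mul_apply]
    simp only [Matrix.mul_diagonal, N]
    rw [← Finset.sum_subset
      (Finset.subset_univ (Finset.univ.filter (fun l : Fin n => (l : ℕ) < k)))]
    · exact Finset.sum_subtype _ (by simp) fun l =>
        gsCoeff M (basisVec M i) l * ‖gsVec M l‖ ^ 2 * gsCoeff M (basisVec M j) l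
    · intro l _ hl
      have hil : (i : Fin n) < l := Fin.lt_def.2 (i.2.trans_le (by simpa using hl))
      rw [gsCoeff_basisVec_of_lt M hil]
      simp
  rw [leadingGram, hfac, Matrix.det_mul, Matrix.det_mul, Matrix.det_transpose, hN,
    Matrix.det_diagonal, one_mul, mul_one]
  exact (Finset.prod_subtype _ (by simp) (fun i => ‖gsVec M i‖ ^ 2)).symm

lemma leadingGram_pos (hM : IsUnit M.det) (k : ℕ) : 0 < leadingGram M k := by
  rw [leadingGram_eq_prod hM]
  exact Finset.prod_pos fun i _ => gsVec_norm_sq_pos hM i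

lemma exists_pos_le_norm_toEuclideanLin {A : Matrix (Fin n) (Fin n) ℝ} (hA : IsUnit A.det) :
    ∃ c : ℝ, 0 < c ∧ ∀ v, c * ‖v‖ ≤ ‖A.toEuclideanLin v‖ := by
  have hker : LinearMap.ker A.toEuclideanLin = ⊥ := by
    refine LinearMap.ker_eq_bot'.2 fun v hv => ?_
    have : (A⁻¹).toEuclideanLin (A.toEuclideanLin v) = v := by
      rw [← LinearMap.comp_apply, ← Matrix.toLpLin_mul_same, Matrix.nonsing_inv_mul _ hA]
      simp
    rw [← this, hv, map_zero]
  obtain ⟨K, hK, h⟩ := A.toEuclideanLin.exists_antilipschitzWith hker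
  refine ⟨(K : ℝ)⁻¹, by positivity, fun v => ?_⟩
  have h1 := h.le_mul_dist v 0
  rw [map_zero, dist_zero_right, dist_zero_right] at h1
  rwa [inv_mul_le_iff₀ (by positivity)]

/-- The Gram-Schmidt vector of `A * U` is the image under `A` of some vector in the coset of the
`i`-th column of `U` modulo the earlier ones, and `gsVec U i` is the shortest vector of that coset.
-/
lemma mul_norm_gsVec_le {A : Matrix (Fin n) (Fin n) ℝ} {c : ℝ}
    (hc0 : 0 ≤ c) (hc : ∀ v, c * ‖v‖ ≤ ‖A.toEuclideanLin v‖) (U : Matrix (Fin n) (Fin n) ℝ)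
    (i : Fin n) : c * ‖gsVec U i‖ ≤ ‖gsVec (A * U) i‖ := by
  have h1 : basisVec (A * U) i - gsVec (A * U) i ∈
      (Submodule.span ℝ (basisVec U '' Set.Iio i)).map A.toEuclideanLin := by
    have := sub_gramSchmidt_mem_span (basisVec (A * U)) i
    rw [Submodule.map_span, Set.image_image]
    simpa only [basisVec_mul, gsVec] using this
  obtain ⟨s, hs, hsA⟩ := h1
  have h2 : gsVec (A * U) i = A.toEuclideanLin (basisVec U i - s) := by
    rw [map_sub, hsA, basisVec_mul, sub_sub_cancel]
  have h3 : ‖gsVec U i‖ ≤ ‖basisVec U i - s‖ :=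
    norm_gramSchmidt_le _ _ (by simpa using hs)
  rw [h2]
  exact (mul_le_mul_of_nonneg_left h3 hc0).trans (hc _)

/-- It is a positive integer. -/
lemma one_le_leadingGram_toRealMatrix {U : Matrix (Fin n) (Fin n) ℤ} (hU : IsUnit U.det) (k : ℕ) :
    1 ≤ leadingGram (toRealMatrix U) k := by
  have h1 := leadingGram_pos (isUnit_det_toRealMatrix hU) k
  have h2 : leadingGram (toRealMatrix U) k =
      ((((U.transpose * U).submatrix (Subtype.val : {i : Fin n // (i : ℕ) < k} → Fin n)
        Subtype.val).det : ℤ) : ℝ) := by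
    have h3 : (toRealMatrix U).transpose * toRealMatrix U = toRealMatrix (U.transpose * U) :=
      (toRealMatrix_mul U.transpose U).symm
    rw [leadingGram, h3]
    exact ((Int.castRingHom ℝ).map_det ((U.transpose * U).submatrix
      (Subtype.val : {i : Fin n // (i : ℕ) < k} → Fin n) Subtype.val)).symm
  rw [h2] at h1 ⊢
  exact_mod_cast h1

/-- Uniformity in `U` is the point: it keeps the LLL potential away from zero over all bases of the
lattice. -/
lemma exists_pos_le_leadingGram {A : Matrix (Fin n) (Fin n) ℝ} (hA : IsUnit A.det) (k : ℕ) :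
    ∃ c : ℝ, 0 < c ∧ ∀ U : Matrix (Fin n) (Fin n) ℤ, IsUnit U.det →
      c ≤ leadingGram (A * toRealMatrix U) k := by
  obtain ⟨c, hc, h⟩ := exists_pos_le_norm_toEuclideanLin hA
  refine ⟨∏ i ∈ Finset.univ.filter (fun i : Fin n => (i : ℕ) < k), c ^ 2,
    Finset.prod_pos fun _ _ => by positivity, fun U hU => ?_⟩
  have h1 := one_le_leadingGram_toRealMatrix hU k
  rw [leadingGram_eq_prod (isUnit_det_toRealMatrix hU)] at h1
  rw [leadingGram_eq_prod (isUnit_det_mul_toRealMatrix hA hU)]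
  calc ∏ i ∈ Finset.univ.filter (fun i : Fin n => (i : ℕ) < k), c ^ 2
      ≤ (∏ i ∈ Finset.univ.filter (fun i : Fin n => (i : ℕ) < k), c ^ 2) *
        ∏ i ∈ Finset.univ.filter (fun i : Fin n => (i : ℕ) < k), ‖gsVec (toRealMatrix U) i‖ ^ 2 :=
        le_mul_of_one_le_right (Finset.prod_nonneg fun _ _ => by positivity) h1
    _ = ∏ i ∈ Finset.univ.filter (fun i : Fin n => (i : ℕ) < k),
        (c * ‖gsVec (toRealMatrix U) i‖) ^ 2 := by
        rw [← Finset.prod_mul_distrib]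
        simp only [mul_pow]
    _ ≤ _ := by
        refine Finset.prod_le_prod (fun _ _ => by positivity) fun i _ => ?_
        have := mul_norm_gsVec_le hc.le h (toRealMatrix U) i
        gcongr

/-- Size reduction does not change the Gram-Schmidt vectors. -/
lemma exists_sizeReduced (hM : IsUnit M.det) :
    ∃ W : Matrix (Fin n) (Fin n) ℤ, IsUnit W.det ∧
      (∀ i, gsVec (M * toRealMatrix W) i = gsVec M i) ∧
      ∀ i j : Fin n, j < i →
        |gsCoeff (M * toRealMatrix W) (basisVec (M * toRealMatrix W) i) j| ≤ 1 / 2 := by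
  choose z hz0 hz using fun i : Fin n => exists_intComb_gsCoeff_le hM i (basisVec M i)
  -- Column `i` of `M W` is `b_i` minus its nearest plane approximation by the columns before it, so
  -- `W` is unit upper triangular.
  let W : Matrix (Fin n) (Fin n) ℤ := fun j i => (if j = i then 1 else 0) - z i j
  have hdet : W.det = 1 := by
    have htri : W.BlockTriangular id := fun l i hli => by
      have hli' : i < l := hli
      simp [W, hli'.ne', hz0 i l (Fin.le_def.1 hli'.le)]
    rw [Matrix.det_of_isUpperTriangular htri]
    exact Finset.prod_eq_one fun i _ => by simp [W, hz0 i i le_rfl]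
  have hb : ∀ i, basisVec (M * toRealMatrix W) i = basisVec M i - intComb M (z i) := by
    intro i
    rw [basisVec_mul, toEuclideanLin_eq_sum, intComb_eq_sum]
    have hW : ∀ j, basisVec (toRealMatrix W) i j = (if j = i then 1 else 0) - (z i j : ℝ) :=
      fun j => by
        change (((if j = i then 1 else 0) - z i j : ℤ) : ℝ) = _
        push_cast
        rfl
    simp [hW, sub_smul, Finset.sum_sub_distrib]
  have hmem : ∀ i, intComb M (z i) ∈ Submodule.span ℝ (basisVec M '' Set.Iio i) := by
    intro i
    rw [intComb_eq_sum]
    refine Submodule.sum_mem _ fun j _ => ?_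
    rcases lt_or_ge j i with h | h
    · exact Submodule.smul_mem _ _ (Submodule.subset_span ⟨j, h, rfl⟩)
    · simp [hz0 i j (Fin.le_def.1 h)]
  have hgs : ∀ i, gsVec (M * toRealMatrix W) i = gsVec M i := by
    intro i
    induction i using WellFoundedLT.induction with
    | _ i ih =>
      have hspan : Submodule.span ℝ (basisVec (M * toRealMatrix W) '' Set.Iio i) =
          Submodule.span ℝ (basisVec M '' Set.Iio i) := by
        rw [← span_gramSchmidt_Iio, ← span_gramSchmidt_Iio ℝ (basisVec M)]
        congr 1
        exact Set.image_congr fun j hj => ih j hj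
      refine gramSchmidt_eq_of_sub_mem_span _ _ ?_ fun j hj => ?_
      · rw [hspan, hb, sub_right_comm]
        exact Submodule.sub_mem _ (sub_gramSchmidt_mem_span _ _) (hmem i)
      · refine inner_gramSchmidt_of_mem_span _ _ ?_
        rw [← hspan]
        exact Submodule.subset_span ⟨j, hj, rfl⟩
  refine ⟨W, by simp [hdet], hgs, fun i j hji => ?_⟩
  have := hz i j hji
  rw [← hb] at this
  rwa [gsCoeff, hgs]

/-- A permutation of the columns is a unimodular change of basis. -/
lemma submatrix_perm_eq_mul (M : Matrix (Fin n) (Fin n) ℝ) (σ : Equiv.Perm (Fin n)) :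
    M.submatrix id σ = M * toRealMatrix ((1 : Matrix (Fin n) (Fin n) ℤ).submatrix id σ) := by
  ext i j
  simp [Matrix.mul_apply, Matrix.one_apply]

lemma isUnit_det_one_submatrix (σ : Equiv.Perm (Fin n)) :
    IsUnit ((1 : Matrix (Fin n) (Fin n) ℤ).submatrix id σ).det := by
  rw [Matrix.det_permute']
  simp

/-- Such a `σ` permutes rows and columns of the leading block simultaneously. -/
lemma leadingGram_submatrix_of_forall {σ : Equiv.Perm (Fin n)} {k : ℕ}
    (hσ : ∀ l : Fin n, (σ l : ℕ) < k ↔ (l : ℕ) < k) :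
    leadingGram (M.submatrix id σ) k = leadingGram M k := by
  have h : ((M.submatrix id σ).transpose * M.submatrix id σ).submatrix
      (Subtype.val : {i : Fin n // (i : ℕ) < k} → Fin n) Subtype.val =
      ((M.transpose * M).submatrix (Subtype.val : {i : Fin n // (i : ℕ) < k} → Fin n)
        Subtype.val).submatrix (σ.subtypePerm (p := fun l : Fin n => (l : ℕ) < k) hσ)
        (σ.subtypePerm (p := fun l : Fin n => (l : ℕ) < k) hσ) := by
    ext i j
    simp [Matrix.mul_apply]
  rw [leadingGram, h, Matrix.det_submatrix_equiv_self, leadingGram]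

/-- The swap keeps the Gram-Schmidt vectors before `i` and replaces the `i`-th by `b_j* + μ b_i*`.
Its squared norm `‖b_j*‖² + μ² ‖b_i*‖²` is below `3/4 ‖b_i*‖²` exactly when the Lovász condition
fails. -/
lemma leadingGram_submatrix_swap_lt (hM : IsUnit M.det) {i j : Fin n} (hij : (i : ℕ) + 1 = j)
    (hlov : ‖gsVec M j‖ ^ 2 < (3 / 4 - gsCoeff M (basisVec M j) i ^ 2) * ‖gsVec M i‖ ^ 2) :
    leadingGram (M.submatrix id (Equiv.swap i j)) j < 3 / 4 * leadingGram M j := by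
  set M' := M.submatrix id (Equiv.swap i j) with hM'
  have hlt : i < j := Fin.lt_def.2 (by omega)
  have hM'u : IsUnit M'.det := by
    rw [hM', submatrix_perm_eq_mul]
    exact isUnit_det_mul_toRealMatrix hM (isUnit_det_one_submatrix _)
  have hb : ∀ l, basisVec M' l = basisVec M (Equiv.swap i j l) := fun l => rfl
  have himg : ∀ l ≤ i, basisVec M' '' Set.Iio l = basisVec M '' Set.Iio l := by
    intro l hl
    refine Set.image_congr fun p hp => ?_
    have hp' : p < i := lt_of_lt_of_le hp hl
    rw [hb, Equiv.swap_apply_of_ne_of_ne hp'.ne (hp'.trans hlt).ne]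
  have hgs : ∀ l < i, gsVec M' l = gsVec M l := by
    intro l hl
    refine gramSchmidt_eq_of_sub_mem_span _ _ ?_ fun p hp => ?_
    · rw [himg l hl.le, hb, Equiv.swap_apply_of_ne_of_ne hl.ne (hl.trans hlt).ne]
      exact sub_gramSchmidt_mem_span _ _
    · refine inner_gramSchmidt_of_mem_span _ _ ?_
      rw [← himg l hl.le]
      exact Submodule.subset_span ⟨p, hp, rfl⟩
  have hIio : Finset.Iio j = insert i (Finset.Iio i) := by
    ext l
    simp only [Finset.mem_insert, Finset.mem_Iio, Fin.lt_def, Fin.ext_iff]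
    omega
  have hgi : gsVec M' i = gsVec M j + gsCoeff M (basisVec M j) i • gsVec M i := by
    refine gramSchmidt_eq_of_sub_mem_span _ _ ?_ fun p hp => ?_
    · have hj := basisVec_eq_gsVec_add M j
      rw [hIio, Finset.sum_insert (by simp), ← add_assoc] at hj
      rw [himg i le_rfl, hb, Equiv.swap_apply_left, sub_eq_of_eq_add' hj, ← span_gramSchmidt_Iio]
      exact Submodule.sum_mem _ fun l hl => Submodule.smul_mem _ _
        (Submodule.subset_span ⟨l, Finset.mem_Iio.1 hl, rfl⟩)
    · rw [hb, Equiv.swap_apply_of_ne_of_ne hp.ne (hp.trans hlt).ne, inner_add_right,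
        inner_smul_right, real_inner_comm, gsVec, gramSchmidt_inv_triangular ℝ _ (hp.trans hlt),
        real_inner_comm, gsVec, gramSchmidt_inv_triangular ℝ _ hp]
      simp
  have hnorm : ‖gsVec M' i‖ ^ 2 < 3 / 4 * ‖gsVec M i‖ ^ 2 := by
    have h0 : inner ℝ (gsVec M j) (gsVec M i) = 0 := gramSchmidt_orthogonal ℝ _ hlt.ne'
    rw [hgi, norm_add_sq_real, inner_smul_right, h0, norm_smul, mul_pow, Real.norm_eq_abs, sq_abs]
    linarith
  have hfil : Finset.univ.filter (fun l : Fin n => (l : ℕ) < (j : ℕ)) =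
      insert i (Finset.Iio i) := by
    rw [← hIio]
    ext l
    simp
  rw [leadingGram_eq_prod hM'u, leadingGram_eq_prod hM, hfil, Finset.prod_insert (by simp),
    Finset.prod_insert (by simp),
    Finset.prod_congr rfl fun l hl => by rw [hgs l (Finset.mem_Iio.1 hl)],
    ← mul_assoc]
  exact mul_lt_mul_of_pos_right hnorm (Finset.prod_pos fun l _ => gsVec_norm_sq_pos hM l)

/-- The potential of a basis: the product of its leading Gram determinants. -/
noncomputable def lllPotential (M : Matrix (Fin n) (Fin n) ℝ) : ℝ :=
  ∏ k : Fin n, leadingGram M k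

/-- Among the leading column sets, only that of size `j` contains `i` but not `j`; the other
determinants are unaffected. -/
lemma lllPotential_submatrix_swap_lt (hM : IsUnit M.det) {i j : Fin n} (hij : (i : ℕ) + 1 = j)
    (hlov : ‖gsVec M j‖ ^ 2 < (3 / 4 - gsCoeff M (basisVec M j) i ^ 2) * ‖gsVec M i‖ ^ 2) :
    lllPotential (M.submatrix id (Equiv.swap i j)) < 3 / 4 * lllPotential M := by
  rw [lllPotential, lllPotential, ← Finset.mul_prod_erase _ _ (Finset.mem_univ j),
    ← Finset.mul_prod_erase _ _ (Finset.mem_univ j), ← mul_assoc]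
  have h : ∀ k ∈ Finset.univ.erase j,
      leadingGram (M.submatrix id (Equiv.swap i j)) k = leadingGram M k := by
    intro k hk
    refine leadingGram_submatrix_of_forall fun l => ?_
    have hkj : (k : ℕ) ≠ j := fun h => (Finset.ne_of_mem_erase hk) (Fin.ext h)
    rw [Equiv.swap_apply_def]
    split_ifs with h1 h2
    · rw [h1]; omega
    · rw [h2]; omega
    · rfl
  rw [Finset.prod_congr rfl h]
  exact mul_lt_mul_of_pos_right (leadingGram_submatrix_swap_lt hM hij hlov)
    (Finset.prod_pos fun k _ => leadingGram_pos hM k)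

/-- Every full-rank lattice has an LLL-reduced basis. -/
theorem exists_isLLLReductionOf {A : Matrix (Fin n) (Fin n) ℝ} (hA : IsUnit A.det) :
    ∃ M, IsLLLReductionOf M A := by
  choose c hc0 hc using fun k : Fin n => exists_pos_le_leadingGram hA k
  let P : Set ℝ := {p | ∃ U : Matrix (Fin n) (Fin n) ℤ, IsUnit U.det ∧
    p = lllPotential (A * toRealMatrix U)}
  have hPlow : ∀ p ∈ P, ∏ k, c k ≤ p := by
    rintro p ⟨U, hU, rfl⟩
    exact Finset.prod_le_prod (fun k _ => (hc0 k).le) fun k _ => hc k U hU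
  have hPne : P.Nonempty := ⟨_, 1, by simp, rfl⟩
  have hbdd : BddBelow P := ⟨_, hPlow⟩
  have hinf : 0 < sInf P :=
    (Finset.prod_pos fun k _ => hc0 k).trans_le (le_csInf hPne hPlow)
  -- In place of running the algorithm, a basis is chosen whose potential is within `4/3` of the
  -- infimum. Size reduction preserves the potential, and a failing Lovász condition would allow a
  -- swap that takes it below `3/4 * 4/3 = 1` times the infimum.
  obtain ⟨p, ⟨U, hU, rfl⟩, hp⟩ := exists_lt_of_csInf_lt hPne
    (show sInf P < 4 / 3 * sInf P by linarith)
  have hAU := isUnit_det_mul_toRealMatrix hA hU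
  obtain ⟨W, hW, hgs, hsize⟩ := exists_sizeReduced hAU
  have hM := isUnit_det_mul_toRealMatrix hAU hW
  set M := A * toRealMatrix U * toRealMatrix W with hMdef
  have hpot : lllPotential M = lllPotential (A * toRealMatrix U) :=
    Finset.prod_congr rfl fun k _ => by
      rw [leadingGram_eq_prod hM, leadingGram_eq_prod hAU]
      exact Finset.prod_congr rfl fun i _ => by rw [hgs]
  refine ⟨M, ⟨hM, hsize, fun i j hij => ?_⟩, U * W, ?_, ?_⟩
  · by_contra! hlov
    have h1 := lllPotential_submatrix_swap_lt hM hij hlov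
    have h2 : lllPotential (M.submatrix id (Equiv.swap i j)) ∈ P := by
      refine ⟨U * W * (1 : Matrix (Fin n) (Fin n) ℤ).submatrix id (Equiv.swap i j), ?_, ?_⟩
      · rw [Matrix.det_mul, Matrix.det_mul]
        exact (hU.mul hW).mul (isUnit_det_one_submatrix _)
      · rw [submatrix_perm_eq_mul, toRealMatrix_mul, toRealMatrix_mul, hMdef]
        simp only [Matrix.mul_assoc]
    have h3 := csInf_le hbdd h2
    linarith
  · rw [Matrix.det_mul]
    exact hU.mul hW
  · rw [hMdef, Matrix.mul_assoc]
    congr 1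
    exact (toRealMatrix_mul U W).symm

end LLL

/-! ### LR-aided decoders exist and approximate the regularized lattice decoder -/

section Approx

open InnerProductSpace

variable {m n : ℕ}

lemma toEuclideanLin_mul_apply {k : ℕ} (A : Matrix (Fin k) (Fin m) ℝ) (B : Matrix (Fin m) (Fin n) ℝ)
    (v : EuclideanSpace ℝ (Fin n)) :
    (A * B).toEuclideanLin v = A.toEuclideanLin (B.toEuclideanLin v) := by
  rw [Matrix.toLpLin_mul_same, LinearMap.comp_apply]

lemma inner_toEuclideanLin_left (A : Matrix (Fin m) (Fin n) ℝ) (u : EuclideanSpace ℝ (Fin n))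
    (v : EuclideanSpace ℝ (Fin m)) :
    inner ℝ (A.toEuclideanLin u) v = inner ℝ u (A.transpose.toEuclideanLin v) := by
  rw [← Matrix.conjTranspose_eq_transpose_of_trivial,
    Matrix.toEuclideanLin_conjTranspose_eq_adjoint, LinearMap.adjoint_inner_right]

lemma intComb_mul_toRealMatrix (A : Matrix (Fin n) (Fin n) ℝ) (U : Matrix (Fin n) (Fin n) ℤ)
    (z : Fin n → ℤ) : intComb (A * toRealMatrix U) z = intComb A (U.mulVec z) := by
  rw [intComb, intComb, toEuclideanLin_mul_apply]
  congr 1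
  ext i
  simp [Matrix.toLpLin_apply, Matrix.mulVec, dotProduct]

lemma intComb_mul (A B : Matrix (Fin n) (Fin n) ℝ) (z : Fin n → ℤ) :
    intComb (A * B) z = A.toEuclideanLin (intComb B z) :=
  toEuclideanLin_mul_apply _ _ _

lemma intComb_smul (φ : ℝ) (A : Matrix (Fin n) (Fin n) ℝ) (z : Fin n → ℤ) :
    intComb (φ • A) z = φ • intComb A z := by
  rw [intComb, map_smul, LinearMap.smul_apply, intComb]

lemma gsVec_smul {φ : ℝ} (M : Matrix (Fin n) (Fin n) ℝ) (i : Fin n) :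
    gsVec (φ • M) i = φ • gsVec M i := by
  have hb : ∀ j, basisVec (φ • M) j = φ • basisVec M j := fun j => by ext k; simp [basisVec]
  refine gramSchmidt_eq_of_sub_mem_span _ _ ?_ fun j hj => ?_
  · rw [hb, ← smul_sub]
    have h := sub_gramSchmidt_mem_span (basisVec M) i
    have h2 := Submodule.mem_map_of_mem (f := φ • LinearMap.id) h
    rw [Submodule.map_span, Set.image_image] at h2
    simpa [hb, gsVec] using h2
  · rw [hb, inner_smul_left, inner_smul_right, gsVec, real_inner_comm,
      gramSchmidt_inv_triangular ℝ _ hj]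
    simp

/-- Gram-Schmidt coefficients are scale invariant. This is needed because the reduction is applied
to `B * G`, whereas decoding takes place in `φ • M`. -/
lemma IsLLLReduced.smul {M : Matrix (Fin n) (Fin n) ℝ} (h : IsLLLReduced M) {φ : ℝ} (hφ : φ ≠ 0) :
    IsLLLReduced (φ • M) := by
  have hb : ∀ j, basisVec (φ • M) j = φ • basisVec M j := fun j => by ext k; simp [basisVec]
  have hc : ∀ i j, gsCoeff (φ • M) (basisVec (φ • M) i) j = gsCoeff M (basisVec M i) j := by
    intro i j
    have h1 := (norm_pos_iff.2 (gsVec_ne_zero h.fullRank j)).ne'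
    rw [gsCoeff, gsCoeff, gsVec_smul, hb, inner_smul_left, inner_smul_right, norm_smul, mul_pow,
      Real.norm_eq_abs, sq_abs]
    simp only [conj_trivial]
    field_simp
  refine ⟨?_, fun i j hij => ?_, fun i j hij => ?_⟩
  · rw [Matrix.det_smul]
    exact (IsUnit.mk0 _ (pow_ne_zero _ hφ)).mul h.fullRank
  · rw [hc]; exact h.sizeReduced i j hij
  · rw [hc, gsVec_smul, gsVec_smul, norm_smul, norm_smul, mul_pow, mul_pow, mul_left_comm]
    exact mul_le_mul_of_nonneg_left (h.lovasz i j hij) (sq_nonneg _)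

lemma exists_transpose_mul_self_eq {P : Matrix (Fin n) (Fin n) ℝ} (hP : P.PosDef) :
    ∃ B : Matrix (Fin n) (Fin n) ℝ, B.transpose * B = P := by
  open scoped MatrixOrder in
  obtain ⟨B, hB⟩ := CStarAlgebra.nonneg_iff_eq_star_mul_self.1 hP.posSemidef.nonneg
  exact ⟨B, by rw [hB, Matrix.star_eq_conjTranspose, Matrix.conjTranspose_eq_transpose_of_trivial]⟩

lemma isUnit_det_of_transpose_mul_self {P B : Matrix (Fin n) (Fin n) ℝ} (hP : P.PosDef)
    (h : B.transpose * B = P) : IsUnit B.det := by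
  have h1 := hP.det_pos
  rw [← h, Matrix.det_mul, Matrix.det_transpose] at h1
  exact isUnit_iff_ne_zero.2 fun h0 => by simp [h0] at h1

lemma posDef_transpose_mul_self_add {S : Matrix (Fin n) (Fin n) ℝ} (hS : S.PosDef)
    (H : Matrix (Fin m) (Fin n) ℝ) : (H.transpose * H + S).PosDef := by
  have := Matrix.posSemidef_conjTranspose_mul_self H
  rw [Matrix.conjTranspose_eq_transpose_of_trivial] at this
  exact Matrix.PosDef.posSemidef_add this hS

lemma inner_toEuclideanLin_nonneg {S : Matrix (Fin n) (Fin n) ℝ} (hS : S.PosDef)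
    (x : EuclideanSpace ℝ (Fin n)) : 0 ≤ inner ℝ x (S.toEuclideanLin x) := by
  obtain ⟨A, rfl⟩ := exists_transpose_mul_self_eq hS
  rw [toEuclideanLin_mul_apply, ← inner_toEuclideanLin_left]
  exact real_inner_self_nonneg

lemma regMetric_nonneg {S : Matrix (Fin n) (Fin n) ℝ} (hS : S.PosDef)
    (y : EuclideanSpace ℝ (Fin m)) (H : Matrix (Fin m) (Fin n) ℝ) (x : EuclideanSpace ℝ (Fin n)) :
    0 ≤ regMetric S y H x :=
  add_nonneg (sq_nonneg _) (inner_toEuclideanLin_nonneg hS x)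

/-- Completing the square: `Bᵀ F = Hᵀ` matches the cross terms and `Bᵀ B = Hᵀ H + S` the quadratic
ones. -/
lemma regMetric_eq {S : Matrix (Fin n) (Fin n) ℝ} {H : Matrix (Fin m) (Fin n) ℝ}
    {B : Matrix (Fin n) (Fin n) ℝ} (hB : IsFeedbackFilter S H B) (hBu : IsUnit B.det)
    (y : EuclideanSpace ℝ (Fin m)) (x : EuclideanSpace ℝ (Fin n)) :
    regMetric S y H x = ‖(forwardFilter H B).toEuclideanLin y - B.toEuclideanLin x‖ ^ 2 +
      (‖y‖ ^ 2 - ‖(forwardFilter H B).toEuclideanLin y‖ ^ 2) := by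
  have h1 : inner ℝ ((forwardFilter H B).toEuclideanLin y) (B.toEuclideanLin x) =
      inner ℝ y (H.toEuclideanLin x) := by
    rw [inner_toEuclideanLin_left, ← toEuclideanLin_mul_apply, forwardFilter,
      Matrix.transpose_mul, Matrix.transpose_transpose, Matrix.transpose_transpose,
      Matrix.mul_assoc, Matrix.nonsing_inv_mul _ hBu, Matrix.mul_one]
  have h2 : ‖B.toEuclideanLin x‖ ^ 2 =
      ‖H.toEuclideanLin x‖ ^ 2 + inner ℝ x (S.toEuclideanLin x) := by
    rw [← real_inner_self_eq_norm_sq, ← real_inner_self_eq_norm_sq, inner_toEuclideanLin_left,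
      inner_toEuclideanLin_left, ← toEuclideanLin_mul_apply, ← toEuclideanLin_mul_apply,
      show B.transpose * B = H.transpose * H + S from hB, map_add, LinearMap.add_apply,
      inner_add_right]
  rw [regMetric, norm_sub_sq_real, norm_sub_sq_real, h1, h2]
  ring

lemma scaling_pos (n : ℕ) (T r : ℝ) {ρ : ℝ} (hρ : 0 < ρ) : 0 < scaling n T r ρ :=
  Real.rpow_pos_of_pos hρ _

lemma exists_isLRAidedDecoder {stage : Matrix (Fin n) (Fin n) ℝ → EuclideanSpace ℝ (Fin n) →
      (Fin n → ℤ) → Prop} (hstage : ∀ M t, IsUnit M.det → ∃ z, stage M t z)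
    {G S : Matrix (Fin n) (Fin n) ℝ} (hG : IsUnit G.det) (hS : S.PosDef) {φ : ℝ} (hφ : φ ≠ 0) :
    ∃ D : Decoder m n, IsLRAidedDecoder stage G φ S D := by
  have h : ∀ (y : EuclideanSpace ℝ (Fin m)) (H : Matrix (Fin m) (Fin n) ℝ),
      ∃ (x : EuclideanSpace ℝ (Fin n)) (B M : Matrix (Fin n) (Fin n) ℝ) (z : Fin n → ℤ),
      IsFeedbackFilter S H B ∧ IsLLLReductionOf M (B * G) ∧
      stage (φ • M) ((forwardFilter H B).toEuclideanLin y) z ∧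
      x = (B⁻¹).toEuclideanLin (intComb (φ • M) z) := by
    intro y H
    obtain ⟨B, hB⟩ := exists_transpose_mul_self_eq (posDef_transpose_mul_self_add hS H)
    have hBu := isUnit_det_of_transpose_mul_self (posDef_transpose_mul_self_add hS H) hB
    obtain ⟨M, hM⟩ := exists_isLLLReductionOf (A := B * G) (by
      rw [Matrix.det_mul]; exact hBu.mul hG)
    obtain ⟨z, hz⟩ := hstage (φ • M) ((forwardFilter H B).toEuclideanLin y)
      (hM.1.smul hφ).fullRank
    exact ⟨_, B, M, z, hB, hM, hz, rfl⟩
  choose D hD using h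
  exact ⟨D, hD⟩

lemma exists_isRounding (M : Matrix (Fin n) (Fin n) ℝ) (t : EuclideanSpace ℝ (Fin n)) :
    ∃ z, IsRounding M t z :=
  ⟨fun i => round ((M⁻¹).toEuclideanLin t i), fun _ => abs_sub_round _⟩

lemma exists_isNearestPlane {M : Matrix (Fin n) (Fin n) ℝ} (hM : IsUnit M.det)
    (t : EuclideanSpace ℝ (Fin n)) : ∃ z, IsNearestPlane M t z := by
  obtain ⟨z, -, hz⟩ := exists_intComb_gsCoeff_le hM n t
  exact ⟨z, (isNearestPlane_iff hM t z).2 fun i => hz i i.2⟩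

/-- A decoding stage which is within the factor `C` of the distance to the lattice in LLL-reduced
bases yields a `C`-approximation of the regularized lattice decoder. -/
lemma IsLRAidedDecoder.isApproxDecoder {stage : Matrix (Fin n) (Fin n) ℝ →
      EuclideanSpace ℝ (Fin n) → (Fin n → ℤ) → Prop} {C : ℝ} (hC : 1 ≤ C)
    (hstage : ∀ M t z, IsLLLReduced M → stage M t z → ∀ z' : Fin n → ℤ,
      ‖t - intComb M z‖ ^ 2 ≤ C * ‖t - intComb M z'‖ ^ 2)
    {G S : Matrix (Fin n) (Fin n) ℝ} (hS : S.PosDef) {φ : ℝ} (hφ : φ ≠ 0) {D : Decoder m n}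
    (hD : IsLRAidedDecoder stage G φ S D) :
    IsApproxDecoder C S {x | ∃ z : Fin n → ℤ, x = φ • intComb G z} D := by
  intro y H
  obtain ⟨B, M, z, hB, ⟨hM, U, hU, hMU⟩, hz, hDy⟩ := hD y H
  have hBu := isUnit_det_of_transpose_mul_self (posDef_transpose_mul_self_add hS H) hB
  have hinv : ∀ v, (B⁻¹).toEuclideanLin (B.toEuclideanLin v) = v := fun v => by
    rw [← toEuclideanLin_mul_apply, Matrix.nonsing_inv_mul _ hBu]; simp
  have hinv' : ∀ v, B.toEuclideanLin ((B⁻¹).toEuclideanLin v) = v := fun v => by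
    rw [← toEuclideanLin_mul_apply, Matrix.mul_nonsing_inv _ hBu]; simp
  have hcomb : ∀ w, intComb (φ • M) w = B.toEuclideanLin (φ • intComb G (U.mulVec w)) := by
    intro w
    rw [intComb_smul, hMU, Matrix.mul_assoc, intComb_mul, map_smul]
    congr 2
    exact intComb_mul_toRealMatrix G U w
  refine ⟨⟨U.mulVec z, by rw [hDy, hcomb, hinv]⟩, ?_⟩
  rintro x ⟨w, rfl⟩
  have hx : B.toEuclideanLin (φ • intComb G w) = intComb (φ • M) (U⁻¹.mulVec w) := by
    rw [hcomb, Matrix.mulVec_mulVec, Matrix.mul_nonsing_inv _ hU, Matrix.one_mulVec]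
  have hmain := hstage _ _ _ (hM.smul hφ) hz (U⁻¹.mulVec w)
  -- This term is the value of the metric at its unconstrained minimizer `B⁻¹ F y`. Being
  -- nonnegative, it can be added to both sides because `1 ≤ C`.
  have hconst : 0 ≤ ‖y‖ ^ 2 - ‖(forwardFilter H B).toEuclideanLin y‖ ^ 2 := by
    have := regMetric_nonneg hS y H ((B⁻¹).toEuclideanLin ((forwardFilter H B).toEuclideanLin y))
    rw [regMetric_eq hB hBu, hinv'] at this
    simpa using this
  rw [regMetric_eq hB hBu, regMetric_eq hB hBu, hDy, hinv', hx]
  nlinarith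

lemma IsLRAidedLinear.isApproxDecoder {L : LatticeDesign n} {T r ρ : ℝ} (hρ : 0 < ρ)
    {S : Matrix (Fin n) (Fin n) ℝ} (hS : S.PosDef) {D : Decoder m n}
    (hD : IsLRAidedLinear L T r ρ S D) :
    IsApproxDecoder ((1 + 2 * (n : ℝ) * (9 / 2 : ℝ) ^ ((n : ℝ) / 2)) ^ 2) S
      (L.scaledLattice T r ρ) D := by
  refine IsLRAidedDecoder.isApproxDecoder (one_le_pow₀ ?_) (fun M t z hM hz z' => ?_) hS
    (scaling_pos n T r hρ).ne' hD
  · have : 0 ≤ 2 * (n : ℝ) * (9 / 2 : ℝ) ^ ((n : ℝ) / 2) := by positivity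
    linarith
  · rw [← mul_pow]
    exact pow_le_pow_left₀ (norm_nonneg _) (hM.norm_sub_le_of_isRounding hz z') 2

lemma IsLRAidedSIC.isApproxDecoder {L : LatticeDesign n} {T r ρ : ℝ} (hρ : 0 < ρ)
    {S : Matrix (Fin n) (Fin n) ℝ} (hS : S.PosDef) {D : Decoder m n}
    (hD : IsLRAidedSIC L T r ρ S D) :
    IsApproxDecoder (((2 : ℝ) ^ ((n : ℝ) / 2)) ^ 2) S (L.scaledLattice T r ρ) D := by
  have h2 : ((2 : ℝ) ^ ((n : ℝ) / 2)) ^ 2 = 2 ^ n := by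
    rw [← Real.rpow_natCast, ← Real.rpow_mul (by norm_num)]
    simp
  rw [h2]
  exact IsLRAidedDecoder.isApproxDecoder (one_le_pow₀ (by norm_num))
    (fun M t z hM hz z' => hM.norm_sq_sub_le_of_isNearestPlane hz z') hS
    (scaling_pos n T r hρ).ne' hD

end Approx

/-! ### The standard Gaussian measure -/

section Gaussian

variable {m : ℕ}

/-- The normalizing constant of the standard Gaussian density. -/
noncomputable def gaussNorm (m : ℕ) : ℝ := (Real.pi / (1 / 2)) ^ ((m : ℝ) / 2)

lemma gaussNorm_pos (m : ℕ) : 0 < gaussNorm m :=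
  Real.rpow_pos_of_pos (by positivity) _

/-- The density of the standard Gaussian measure. -/
noncomputable def gaussDensity (v : EuclideanSpace ℝ (Fin m)) : ℝ≥0∞ :=
  ENNReal.ofReal ((gaussNorm m)⁻¹ * Real.exp (-(1 / 2) * ‖v‖ ^ 2))

@[fun_prop] lemma measurable_gaussDensity :
    Measurable (gaussDensity : EuclideanSpace ℝ (Fin m) → ℝ≥0∞) := by
  unfold gaussDensity
  fun_prop

lemma gaussDensity_le_of_norm_le {u v : EuclideanSpace ℝ (Fin m)} (h : ‖u‖ ≤ ‖v‖) :
    gaussDensity v ≤ gaussDensity u := by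
  have := gaussNorm_pos m
  unfold gaussDensity
  have h2 := pow_le_pow_left₀ (norm_nonneg u) h 2
  refine ENNReal.ofReal_le_ofReal (mul_le_mul_of_nonneg_left (Real.exp_le_exp.2 ?_) (by positivity))
  linarith

/-- Both finite measures have the same characteristic function. -/
lemma stdGaussian_eq_withDensity :
    stdGaussian (EuclideanSpace ℝ (Fin m)) = volume.withDensity gaussDensity := by
  have hpos := gaussNorm_pos m
  have hint : ∫ v : EuclideanSpace ℝ (Fin m), Real.exp (-(1 / 2) * ‖v‖ ^ 2) = gaussNorm m := by
    rw [GaussianFourier.integral_rexp_neg_mul_sq_norm (by norm_num)]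
    simp [gaussNorm]
  have hI : Integrable fun v : EuclideanSpace ℝ (Fin m) => Real.exp (-(1 / 2) * ‖v‖ ^ 2) :=
    Integrable.of_integral_ne_zero (by rw [hint]; exact hpos.ne')
  have hfin : IsFiniteMeasure ((volume : Measure (EuclideanSpace ℝ (Fin m))).withDensity
      gaussDensity) :=
    isFiniteMeasure_withDensity_ofReal (hI.const_mul _).2
  refine Measure.ext_of_charFun (funext fun t => ?_)
  rw [charFun_stdGaussian, charFun_apply, integral_withDensity_eq_integral_toReal_smul
    measurable_gaussDensity (ae_of_all _ fun _ => ENNReal.ofReal_lt_top)]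
  have h1 : ∀ v : EuclideanSpace ℝ (Fin m),
      (gaussDensity v).toReal • Complex.exp ((inner ℝ v t : ℝ) * Complex.I) =
      ((gaussNorm m)⁻¹ : ℂ) *
        Complex.exp (-(1 / 2) * ‖v‖ ^ 2 + Complex.I * (inner ℝ t v : ℝ)) := by
    intro v
    rw [gaussDensity, ENNReal.toReal_ofReal (by positivity), Complex.real_smul, Complex.exp_add,
      real_inner_comm]
    push_cast
    ring_nf
  simp_rw [h1]
  rw [integral_const_mul, GaussianFourier.integral_cexp_neg_mul_sq_norm_add (by norm_num)]
  have h2 : ((Real.pi : ℂ) / (1 / 2)) ^ (Module.finrank ℝ (EuclideanSpace ℝ (Fin m)) / 2 : ℂ) =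
      (gaussNorm m : ℂ) := by
    rw [gaussNorm, Complex.ofReal_cpow (by positivity)]
    simp
  rw [h2, ← mul_assoc, inv_mul_cancel₀ (by exact_mod_cast hpos.ne'), one_mul, Complex.I_sq]
  congr 1
  ring

lemma stdGaussian_preimage_add (a : EuclideanSpace ℝ (Fin m)) {A : Set (EuclideanSpace ℝ (Fin m))}
    (hA : MeasurableSet A) :
    stdGaussian (EuclideanSpace ℝ (Fin m)) {w | a + w ∈ A} = ∫⁻ y in A, gaussDensity (y - a) := by
  have hm : MeasurableSet {w | a + w ∈ A} := (measurable_const_add a) hA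
  rw [stdGaussian_eq_withDensity, withDensity_apply _ hm, ← lintegral_indicator hm,
    ← lintegral_indicator hA,
    ← lintegral_sub_right_eq_self ({w | a + w ∈ A}.indicator gaussDensity) a]
  refine lintegral_congr fun y => ?_
  by_cases hy : y ∈ A
  · rw [Set.indicator_of_mem hy, Set.indicator_of_mem]
    simpa using hy
  · rw [Set.indicator_of_notMem hy, Set.indicator_of_notMem]
    simpa using hy

/-- Two Gaussian measures whose means are at distance at most one cannot be distinguished
reliably. -/
lemma exists_pos_le_stdGaussian_add (m : ℕ) : ∃ c : ℝ≥0∞, 0 < c ∧ c ≠ ∞ ∧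
    ∀ (a a' : EuclideanSpace ℝ (Fin m)) (A A' : Set (EuclideanSpace ℝ (Fin m))),
      MeasurableSet A → MeasurableSet A' → A ∪ A' = Set.univ → ‖a - a'‖ ≤ 1 →
      c ≤ stdGaussian (EuclideanSpace ℝ (Fin m)) {w | a + w ∈ A} +
        stdGaussian (EuclideanSpace ℝ (Fin m)) {w | a' + w ∈ A'} := by
  -- The density at distance `2` from the mean. The unit ball around `a` lies within distance `2` of
  -- both `a` and `a'`, so both shifted densities are at least `g` on it.
  let g : ℝ≥0∞ := ENNReal.ofReal ((gaussNorm m)⁻¹ * Real.exp (-(1 / 2) * 2 ^ 2))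
  have hg : 0 < g := ENNReal.ofReal_pos.2 (by have := gaussNorm_pos m; positivity)
  have hle : ∀ v : EuclideanSpace ℝ (Fin m), ‖v‖ ≤ 2 → g ≤ gaussDensity v := by
    intro v hv
    have := gaussNorm_pos m
    have h2 := pow_le_pow_left₀ (norm_nonneg v) hv 2
    refine ENNReal.ofReal_le_ofReal
      (mul_le_mul_of_nonneg_left (Real.exp_le_exp.2 ?_) (by positivity))
    linarith
  have hset : ∀ (b a : EuclideanSpace ℝ (Fin m)) (A : Set (EuclideanSpace ℝ (Fin m))),
      MeasurableSet A → ‖b - a‖ ≤ 1 →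
      g * volume (A ∩ Metric.closedBall b 1) ≤
        stdGaussian (EuclideanSpace ℝ (Fin m)) {w | a + w ∈ A} := by
    intro b a A hA hab
    rw [stdGaussian_preimage_add a hA, ← setLIntegral_const]
    refine (setLIntegral_mono (by fun_prop) fun y hy => hle _ ?_).trans
      (lintegral_mono_set Set.inter_subset_left)
    have h1 := hy.2
    rw [Metric.mem_closedBall, dist_eq_norm] at h1
    have h2 := norm_add_le (y - b) (b - a)
    rw [sub_add_sub_cancel] at h2
    linarith
  refine ⟨g * volume (Metric.closedBall (0 : EuclideanSpace ℝ (Fin m)) 1),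
    ENNReal.mul_pos hg.ne' (Metric.measure_closedBall_pos _ _ one_pos).ne',
    ENNReal.mul_ne_top ENNReal.ofReal_ne_top measure_closedBall_lt_top.ne, ?_⟩
  intro a a' A A' hA hA' hAA haa
  rw [← Measure.addHaar_closedBall_center volume a 1]
  calc g * volume (Metric.closedBall a 1)
      ≤ g * (volume (A ∩ Metric.closedBall a 1) + volume (A' ∩ Metric.closedBall a 1)) := by
        gcongr
        refine le_trans (measure_mono ?_) (measure_union_le _ _)
        rw [← Set.union_inter_distrib_right, hAA, Set.univ_inter]
    _ ≤ _ := by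
        rw [mul_add]
        exact add_le_add (hset a a A hA (by simp)) (hset a a' A' hA' haa)

/-- All moments of a Gaussian vector are finite, so its tails decay faster than any power. -/
lemma exists_stdGaussian_tail_le (m k : ℕ) : ∃ C : ℝ, 0 ≤ C ∧ ∀ R : ℝ, 0 < R →
    stdGaussian (EuclideanSpace ℝ (Fin m)) {w | R < ‖w‖} ≤ ENNReal.ofReal (C * (R ^ k)⁻¹) := by
  have hI : Integrable (fun w => ‖w‖ ^ k) (stdGaussian (EuclideanSpace ℝ (Fin m))) :=
    (IsGaussian.memLp_id (stdGaussian (EuclideanSpace ℝ (Fin m))) k (by simp)).integrable_norm_pow'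
  refine ⟨∫ w, ‖w‖ ^ k ∂(stdGaussian (EuclideanSpace ℝ (Fin m))),
    integral_nonneg fun _ => by positivity, fun R hR => ?_⟩
  have h1 := mul_meas_ge_le_integral_of_nonneg (ae_of_all _ fun w => by positivity) hI (R ^ k)
  have h2 : (stdGaussian (EuclideanSpace ℝ (Fin m))).real {w | R < ‖w‖} ≤
      (stdGaussian (EuclideanSpace ℝ (Fin m))).real {w | R ^ k ≤ ‖w‖ ^ k} :=
    measureReal_mono fun w (hw : R < ‖w‖) => pow_le_pow_left₀ hR.le hw.le k
  rw [← ofReal_measureReal]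
  refine ENNReal.ofReal_le_ofReal ?_
  rw [← div_eq_mul_inv, le_div_iff₀ (by positivity), mul_comm]
  exact (mul_le_mul_of_nonneg_left h2 (by positivity)).trans h1

end Gaussian

/-! ### Error probabilities -/

section ErrorProb

variable {m n : ℕ} {X : Set (EuclideanSpace ℝ (Fin n))}
  {μ : Measure (Matrix (Fin m) (Fin n) ℝ)}

lemma measurable_channel : Measurable
    (fun p : EuclideanSpace ℝ (Fin n) × Matrix (Fin m) (Fin n) ℝ × EuclideanSpace ℝ (Fin m) =>
      p.2.1.toEuclideanLin p.1 + p.2.2) := by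
  have hentry : ∀ i j, Measurable fun H : Matrix (Fin m) (Fin n) ℝ => H i j := fun i j =>
    (measurable_pi_apply j).comp (measurable_pi_apply (X := fun _ : Fin m => Fin n → ℝ) i)
  have hlin : Measurable (fun p : EuclideanSpace ℝ (Fin n) × Matrix (Fin m) (Fin n) ℝ ×
      EuclideanSpace ℝ (Fin m) => p.2.1.toEuclideanLin p.1) := by
    refine (WithLp.measurable_toLp 2 (Fin m → ℝ)).comp (measurable_pi_lambda _ fun i => ?_)
    change Measurable fun p : EuclideanSpace ℝ (Fin n) × Matrix (Fin m) (Fin n) ℝ ×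
      EuclideanSpace ℝ (Fin m) => ∑ j, p.2.1 i j * p.1 j
    refine Finset.measurable_sum _ fun j _ => ?_
    exact ((hentry i j).comp (measurable_fst.comp measurable_snd)).mul (by fun_prop)
  exact hlin.add (measurable_snd.comp measurable_snd)

lemma measurableSet_decoder_ne {D : Decoder m n}
    (hD : Measurable (fun p : EuclideanSpace ℝ (Fin m) × Matrix (Fin m) (Fin n) ℝ => D p.1 p.2)) :
    MeasurableSet {p : EuclideanSpace ℝ (Fin n) × Matrix (Fin m) (Fin n) ℝ ×
      EuclideanSpace ℝ (Fin m) | D (p.2.1.toEuclideanLin p.1 + p.2.2) p.2.1 ≠ p.1} :=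
  (measurableSet_eq_fun (hD.comp (measurable_channel.prodMk (measurable_fst.comp measurable_snd)))
    measurable_fst).compl

lemma prod_uniformOn_apply [IsProbabilityMeasure μ] (hX : X.Finite)
    {E : Set (EuclideanSpace ℝ (Fin n) × Matrix (Fin m) (Fin n) ℝ × EuclideanSpace ℝ (Fin m))}
    (hE : MeasurableSet E) :
    ((uniformOn X).prod (μ.prod (stdGaussian (EuclideanSpace ℝ (Fin m))))) E =
      (hX.toFinset.card : ℝ≥0∞)⁻¹ * ∫⁻ H, ∑ x ∈ hX.toFinset,
        stdGaussian (EuclideanSpace ℝ (Fin m)) {w | (x, H, w) ∈ E} ∂μ := by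
  have hslice : ∀ x, MeasurableSet (Prod.mk x ⁻¹' E) := fun x => measurable_prodMk_left hE
  rw [Measure.prod_apply hE, lintegral_finsetSum]
  · rw [uniformOn, ProbabilityTheory.cond, lintegral_smul_measure, Measure.count_apply_finite _ hX,
      smul_eq_mul]
    congr 1
    have h1 := lintegral_finset (μ := Measure.count) hX.toFinset fun x =>
      (μ.prod (stdGaussian (EuclideanSpace ℝ (Fin m)))) (Prod.mk x ⁻¹' E)
    rw [hX.coe_toFinset] at h1
    rw [h1]
    refine Finset.sum_congr rfl fun x _ => ?_
    rw [Measure.count_singleton, mul_one, Measure.prod_apply (hslice x)]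
    rfl
  · intro x _
    exact measurable_measure_prodMk_left (hslice x)

/-- Maximum-likelihood decoding minimizes the error probability. -/
lemma IsMLDecoder.errorProb_le [IsProbabilityMeasure μ] (hX : X.Finite) (hX0 : X.Nonempty)
    {D : Decoder m n} (hD : IsMLDecoder X D) (D' : Decoder m n) :
    errorProb X μ D ≤ errorProb X μ D' := by
  have := isProbabilityMeasure_uniformOn hX hX0
  set Q := (uniformOn X).prod (μ.prod (stdGaussian (EuclideanSpace ℝ (Fin m)))) with hQ
  -- The competitor `D'` may be nonmeasurable, so its error event is replaced by a measurable hull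
  -- of equal measure; outside `E` it still decodes correctly.
  set E := toMeasurable Q {p | D' (p.2.1.toEuclideanLin p.1 + p.2.2) p.2.1 ≠ p.1} with hE
  have hEm : MeasurableSet E := measurableSet_toMeasurable _ _
  have hDm := measurableSet_decoder_ne hD.measurable
  have hcorr : Q Eᶜ ≤ Q {p | D (p.2.1.toEuclideanLin p.1 + p.2.2) p.2.1 ≠ p.1}ᶜ := by
    rw [hQ, prod_uniformOn_apply hX hEm.compl, prod_uniformOn_apply hX hDm.compl]
    gcongr _ * ?_
    refine lintegral_mono fun H => ?_
    have hA : ∀ x, MeasurableSet {y | (x, H, y - H.toEuclideanLin x) ∈ Eᶜ} := fun x =>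
      (show Measurable fun y => (x, H, y - H.toEuclideanLin x) by fun_prop) hEm.compl
    have hA' : ∀ x, MeasurableSet {y | D y H = x} := fun x =>
      (hD.measurable.comp measurable_prodMk_right) (measurableSet_singleton x)
    have h1 : ∀ x, stdGaussian (EuclideanSpace ℝ (Fin m)) {w | (x, H, w) ∈ Eᶜ} =
        ∫⁻ y, {y | (x, H, y - H.toEuclideanLin x) ∈ Eᶜ}.indicator
          (fun y => gaussDensity (y - H.toEuclideanLin x)) y := by
      intro x
      rw [lintegral_indicator (hA x), ← stdGaussian_preimage_add _ (hA x)]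
      congr 1
      ext w
      simp only [Set.mem_ofPred_eq, add_sub_cancel_left]
    have h2 : ∀ x, stdGaussian (EuclideanSpace ℝ (Fin m)) {w | (x, H, w) ∈
        {p : EuclideanSpace ℝ (Fin n) × Matrix (Fin m) (Fin n) ℝ × EuclideanSpace ℝ (Fin m) |
          D (p.2.1.toEuclideanLin p.1 + p.2.2) p.2.1 ≠ p.1}ᶜ} =
        ∫⁻ y, {y | D y H = x}.indicator (fun y => gaussDensity (y - H.toEuclideanLin x)) y := by
      intro x
      rw [lintegral_indicator (hA' x), ← stdGaussian_preimage_add _ (hA' x)]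
      congr 1
      ext w
      simp
    simp_rw [h1, h2]
    rw [← lintegral_finsetSum _ fun x _ => Measurable.indicator (by fun_prop) (hA x),
      ← lintegral_finsetSum _ fun x _ => Measurable.indicator (by fun_prop) (hA' x)]
    refine lintegral_mono fun y => ?_
    have hmem : ∀ x, y ∈ {y | (x, H, y - H.toEuclideanLin x) ∈ Eᶜ} → D' y H = x := by
      intro x hx
      by_contra hne
      refine hx (subset_toMeasurable _ _ ?_)
      simpa using hne
    -- For fixed `H` and `y`, at most the codeword `D' y H` is decoded correctly, and its likelihood
    -- is at most that of the ML output.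
    calc ∑ x ∈ hX.toFinset, {y | (x, H, y - H.toEuclideanLin x) ∈ Eᶜ}.indicator
          (fun y => gaussDensity (y - H.toEuclideanLin x)) y
        ≤ ∑ x ∈ hX.toFinset, if x = D' y H then gaussDensity (y - H.toEuclideanLin (D y H))
          else 0 := by
          refine Finset.sum_le_sum fun x hx => ?_
          by_cases hy : y ∈ {y | (x, H, y - H.toEuclideanLin x) ∈ Eᶜ}
          · rw [Set.indicator_of_mem hy, if_pos (hmem x hy).symm]
            exact gaussDensity_le_of_norm_le (le_of_sq_le_sq
              (hD.le y H x (hX.mem_toFinset.1 hx)) (norm_nonneg _))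
          · rw [Set.indicator_of_notMem hy]
            exact zero_le
      _ ≤ gaussDensity (y - H.toEuclideanLin (D y H)) := by
          rw [Finset.sum_ite_eq']
          split_ifs
          · exact le_rfl
          · exact zero_le
      _ = {y' | D y' H = D y H}.indicator
            (fun y' => gaussDensity (y' - H.toEuclideanLin (D y H))) y := by
          rw [Set.indicator_of_mem]; rfl
      _ ≤ _ := Finset.single_le_sum
          (f := fun x => {y | D y H = x}.indicator
            (fun y => gaussDensity (y - H.toEuclideanLin x)) y)
          (fun _ _ => zero_le) (hX.mem_toFinset.2 (hD.mem y H))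
  have hfin : errorProb X μ D' = Q E := (measure_toMeasurable _).symm
  have h1 := prob_compl_eq_one_sub (μ := Q) hDm.compl
  have h2 := prob_compl_eq_one_sub (μ := Q) hEm.compl
  rw [compl_compl] at h1 h2
  rw [hfin, errorProb, ← hQ, h1, h2]
  exact tsub_le_tsub_left hcorr 1

end ErrorProb

/-! ### Codebooks -/

section Codebook

variable {m n : ℕ}

/-- A fixed positive fraction of the codewords remain codewords after adding a short `d`, uniformly
in the lattice. Cover `K` by `N` balls of radius `ε / 4`; subtracting one codeword of a ball from
the others there moves them injectively into the ball of radius `ε / 2` about zero, where adding `d`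
stays within `K`. -/
lemma exists_card_le_mul_card_filter {E : Type*} [NormedAddCommGroup E] [DecidableEq E] {K : Set E}
    (hK : IsCompact K) (hK0 : (0 : E) ∈ interior K) :
    ∃ (N : ℕ) (δ : ℝ), 0 < δ ∧ ∀ (Λ : AddSubgroup E) (hX : ((Λ : Set E) ∩ K).Finite),
      ∀ d ∈ Λ, ‖d‖ ≤ δ →
        hX.toFinset.card ≤ N * (hX.toFinset.filter fun x => x + d ∈ hX.toFinset).card := by
  obtain ⟨ε, hε, hball⟩ := Metric.mem_nhds_iff.1 (mem_interior_iff_mem_nhds.1 hK0)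
  obtain ⟨t, -, htfin, ht⟩ := hK.finite_cover_balls (e := ε / 4) (by positivity)
  refine ⟨htfin.toFinset.card, ε / 2, by positivity, fun Λ hX d hd hdδ => ?_⟩
  set F := hX.toFinset with hF
  have hcover : F ⊆ htfin.toFinset.biUnion fun c => F.filter fun x => dist x c < ε / 4 := by
    intro x hx
    have hxK : x ∈ K := (hX.mem_toFinset.1 hx).2
    obtain ⟨c, hc, hxc⟩ := Set.mem_iUnion₂.1 (ht hxK)
    exact Finset.mem_biUnion.2 ⟨c, htfin.mem_toFinset.2 hc, Finset.mem_filter.2 ⟨hx, hxc⟩⟩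
  refine (Finset.card_le_card hcover).trans (Finset.card_biUnion_le_card_mul _ _ _ fun c _ => ?_)
  rcases (F.filter fun x => dist x c < ε / 4).eq_empty_or_nonempty with h | ⟨x₀, hx₀⟩
  · rw [h]; exact Nat.zero_le _
  rw [Finset.mem_filter] at hx₀
  refine Finset.card_le_card_of_injOn (fun x => x - x₀) (fun x hx => ?_)
    (fun x _ y _ hxy => sub_left_injective hxy)
  have hx' := Finset.mem_filter.1 (Finset.mem_coe.1 hx)
  have hnorm : ‖x - x₀‖ < ε / 2 := by
    rw [← dist_eq_norm]
    have := dist_triangle_right x x₀ c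
    linarith [hx'.2, hx₀.2]
  have hΛ : x - x₀ ∈ Λ :=
    Λ.sub_mem (hX.mem_toFinset.1 hx'.1).1 (hX.mem_toFinset.1 hx₀.1).1
  rw [Finset.mem_coe, Finset.mem_filter, hX.mem_toFinset, hX.mem_toFinset]
  refine ⟨⟨hΛ, hball ?_⟩, Λ.add_mem hΛ hd, hball ?_⟩
  · rw [mem_ball_zero_iff]; linarith
  · rw [mem_ball_zero_iff]; linarith [norm_add_le (x - x₀) d]

lemma intComb_add (A : Matrix (Fin n) (Fin n) ℝ) (z w : Fin n → ℤ) :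
    intComb A (z + w) = intComb A z + intComb A w := by
  simp [intComb_eq_sum, add_smul, Finset.sum_add_distrib]

lemma intComb_neg (A : Matrix (Fin n) (Fin n) ℝ) (z : Fin n → ℤ) :
    intComb A (-z) = -intComb A z := by
  simp [intComb_eq_sum, Finset.sum_neg_distrib]

namespace LatticeDesign

/-- The scaled lattice as an additive subgroup. -/
noncomputable def scaledSubgroup (L : LatticeDesign n) (T r ρ : ℝ) :
    AddSubgroup (EuclideanSpace ℝ (Fin n)) where
  carrier := L.scaledLattice T r ρ
  zero_mem' := ⟨0, by simp [intComb_eq_sum]⟩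
  add_mem' := by
    rintro _ _ ⟨z, rfl⟩ ⟨w, rfl⟩
    exact ⟨z + w, by rw [intComb_add, smul_add]⟩
  neg_mem' := by
    rintro _ ⟨z, rfl⟩
    exact ⟨-z, by rw [intComb_neg, smul_neg]⟩

lemma zero_mem_codebook (L : LatticeDesign n) (T r ρ : ℝ) : 0 ∈ L.codebook T r ρ :=
  ⟨(L.scaledSubgroup T r ρ).zero_mem, interior_subset L.zero_mem_interior⟩

lemma codebook_finite (L : LatticeDesign n) (T r : ℝ) {ρ : ℝ} (hρ : 0 < ρ) :
    (L.codebook T r ρ).Finite := by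
  obtain ⟨K, hK⟩ := L.region_compact.isBounded.exists_norm_le
  obtain ⟨c, hc, hcle⟩ := exists_pos_le_norm_toEuclideanLin L.G_fullRank
  have hφ := scaling_pos n T r hρ
  set φ := scaling n T r ρ
  have hfin : Set.Finite {z : Fin n → ℤ | ‖φ • intComb L.G z‖ ≤ K} := by
    refine (Set.finite_Icc (fun _ => -⌈K / (φ * c)⌉) (fun _ => ⌈K / (φ * c)⌉)).subset fun z hz => ?_
    have hz' : ‖φ • intComb L.G z‖ ≤ K := hz
    have h1 := hcle (WithLp.toLp 2 fun i => (z i : ℝ))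
    rw [norm_smul, Real.norm_of_nonneg hφ.le] at hz'
    have h2 : ∀ i, |z i| ≤ ⌈K / (φ * c)⌉ := by
      intro i
      have h3 := PiLp.norm_apply_le (WithLp.toLp 2 fun i => (z i : ℝ)) i
      have h4 : φ * (c * |(z i : ℝ)|) ≤ K := by
        refine le_trans ?_ hz'
        gcongr
        refine le_trans ?_ h1
        gcongr
        exact h3
      have h5 : |(z i : ℝ)| ≤ K / (φ * c) := by
        rw [le_div_iff₀ (by positivity)]; linarith
      exact_mod_cast h5.trans (Int.le_ceil _)
    exact ⟨fun i => (abs_le.1 (h2 i)).1, fun i => (abs_le.1 (h2 i)).2⟩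
  refine (hfin.image fun z => φ • intComb L.G z).subset ?_
  rintro _ ⟨⟨z, rfl⟩, hz⟩
  exact ⟨z, hK _ hz, rfl⟩

end LatticeDesign

end Codebook

/-! ### Error probabilities and short vectors -/

section ShortVectors

variable {m n : ℕ}

/-- The channels which map a nonzero lattice vector of norm at most `a` to a vector of norm at
most `b`. -/
def shortVectorEvent (Λ : Set (EuclideanSpace ℝ (Fin n))) (a b : ℝ) :
    Set (Matrix (Fin m) (Fin n) ℝ) :=
  {H | ∃ d ∈ Λ, d ≠ 0 ∧ ‖d‖ ≤ a ∧ ‖H.toEuclideanLin d‖ ≤ b}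

/-- If the channel maps a short lattice vector to a short vector, every decoder errs with
probability bounded away from zero. -/
lemma exists_mul_measure_shortVectorEvent_le (m : ℕ) {K : Set (EuclideanSpace ℝ (Fin n))}
    (hK : IsCompact K) (hK0 : 0 ∈ interior K) :
    ∃ (M δ : ℝ), 0 ≤ M ∧ 0 < δ ∧ ∀ (Λ : AddSubgroup (EuclideanSpace ℝ (Fin n)))
      (_ : ((Λ : Set (EuclideanSpace ℝ (Fin n))) ∩ K).Finite)
      (μ : Measure (Matrix (Fin m) (Fin n) ℝ)) (_ : IsProbabilityMeasure μ) (D : Decoder m n)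
      (_ : Measurable
        (fun p : EuclideanSpace ℝ (Fin m) × Matrix (Fin m) (Fin n) ℝ => D p.1 p.2)),
      μ (shortVectorEvent Λ δ 1) ≤
        ENNReal.ofReal M * errorProb ((Λ : Set (EuclideanSpace ℝ (Fin n))) ∩ K) μ D := by
  classical
  obtain ⟨N, δ, hδ, hN⟩ := exists_card_le_mul_card_filter hK hK0
  obtain ⟨c, hc, hc', htwo⟩ := exists_pos_le_stdGaussian_add m
  -- A fraction `1 / N` of the codewords have a partner `x + d`, each pair has total error
  -- probability at least `c`, and each codeword occurs in at most two pairs.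
  refine ⟨((2 * N : ℝ≥0∞) / c).toReal, δ, ENNReal.toReal_nonneg, hδ, fun Λ hX μ hμ D hD => ?_⟩
  rw [ENNReal.ofReal_toReal (ENNReal.div_ne_top (by finiteness) hc.ne')]
  set F := hX.toFinset with hF
  have hErr := measurableSet_decoder_ne hD
  set Err := {p : EuclideanSpace ℝ (Fin n) × Matrix (Fin m) (Fin n) ℝ ×
    EuclideanSpace ℝ (Fin m) | D (p.2.1.toEuclideanLin p.1 + p.2.2) p.2.1 ≠ p.1} with hErrdef
  let p : EuclideanSpace ℝ (Fin n) → Matrix (Fin m) (Fin n) ℝ → ℝ≥0∞ := fun x H =>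
    stdGaussian (EuclideanSpace ℝ (Fin m)) {w | (x, H, w) ∈ Err}
  have hpm : ∀ x, Measurable (p x) := fun x =>
    measurable_measure_prodMk_left (measurable_prodMk_left (x := x) hErr)
  have hprob : errorProb ((Λ : Set (EuclideanSpace ℝ (Fin n))) ∩ K) μ D =
      (F.card : ℝ≥0∞)⁻¹ * ∫⁻ H, ∑ x ∈ F, p x H ∂μ := prod_uniformOn_apply hX hErr
  have hF0 : (F.card : ℝ≥0∞) ≠ 0 := by
    rw [Nat.cast_ne_zero, Finset.card_ne_zero]
    exact ⟨0, hX.mem_toFinset.2 ⟨Λ.zero_mem, interior_subset hK0⟩⟩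
  have hpair : ∀ H : Matrix (Fin m) (Fin n) ℝ, ∀ x d, d ≠ 0 → ‖H.toEuclideanLin d‖ ≤ 1 →
      c ≤ p x H + p (x + d) H := by
    intro H x d hd hHd
    have hm : ∀ x, MeasurableSet {y | D y H ≠ x} := fun x =>
      (hD.comp measurable_prodMk_right) (measurableSet_singleton x).compl
    refine htwo (H.toEuclideanLin x) (H.toEuclideanLin (x + d)) {y | D y H ≠ x}
      {y | D y H ≠ x + d} (hm x) (hm (x + d)) ?_ ?_
    · refine Set.eq_univ_of_forall fun y => ?_
      by_cases hy : D y H = x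
      · refine Or.inr fun h => hd ?_
        rw [hy] at h
        simpa using h.symm
      · exact Or.inl hy
    · rw [map_add, sub_add_cancel_left, norm_neg]
      exact hHd
  have hsum : ∀ H ∈ shortVectorEvent (m := m) (Λ : Set (EuclideanSpace ℝ (Fin n))) δ 1,
      c * F.card ≤ 2 * N * ∑ x ∈ F, p x H := by
    rintro H ⟨d, hdΛ, hd0, hdδ, hHd⟩
    set Y := F.filter fun x => x + d ∈ F with hY
    have h1 : (F.card : ℝ≥0∞) ≤ N * Y.card := by exact_mod_cast hN Λ hX d hdΛ hdδ
    have h2 : Y.card * c ≤ ∑ x ∈ Y, (p x H + p (x + d) H) := by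
      rw [← nsmul_eq_mul]
      exact Finset.card_nsmul_le_sum _ _ _ fun x _ => hpair H x d hd0 hHd
    have h3 : ∑ x ∈ Y, p x H ≤ ∑ x ∈ F, p x H :=
      Finset.sum_le_sum_of_subset (Finset.filter_subset _ _)
    have h4 : ∑ x ∈ Y, p (x + d) H ≤ ∑ x ∈ F, p x H := by
      have h5 : ∑ x ∈ Y, p (x + d) H = ∑ x ∈ Y.image (· + d), p x H :=
        (Finset.sum_image (f := fun x => p x H) fun x _ y _ h => add_right_cancel h).symm
      rw [h5]
      refine Finset.sum_le_sum_of_subset fun x hx => ?_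
      obtain ⟨x', hx', rfl⟩ := Finset.mem_image.1 hx
      exact (Finset.mem_filter.1 hx').2
    calc c * F.card ≤ c * (N * Y.card) := by gcongr
      _ = N * (Y.card * c) := by ring
      _ ≤ N * (∑ x ∈ F, p x H + ∑ x ∈ F, p x H) := by
          gcongr
          refine h2.trans ?_
          rw [Finset.sum_add_distrib]
          exact add_le_add h3 h4
      _ = _ := by ring
  have hfm : Measurable fun H => 2 * N * ∑ x ∈ F, p x H :=
    (Finset.measurable_sum _ fun x _ => hpm x).const_mul _
  -- Markov's inequality, applied to a superlevel set containing the event, so measurability of the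
  -- event itself is not needed.
  have hmarkov : c * F.card * μ (shortVectorEvent Λ δ 1) ≤
      2 * N * ∫⁻ H, ∑ x ∈ F, p x H ∂μ := by
    rw [← lintegral_const_mul' _ _ (by finiteness)]
    exact (mul_le_mul_right (measure_mono hsum) _).trans (mul_meas_ge_le_lintegral hfm _)
  rw [hprob, ENNReal.div_eq_inv_mul, mul_assoc, ← ENNReal.div_eq_inv_mul,
    ENNReal.le_div_iff_mul_le (Or.inl hc.ne') (Or.inl hc')]
  calc μ (shortVectorEvent Λ δ 1) * c
      = (F.card : ℝ≥0∞)⁻¹ * (c * F.card * μ (shortVectorEvent Λ δ 1)) := by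
        have := ENNReal.inv_mul_cancel hF0 (ENNReal.natCast_ne_top _)
        calc _ = ((F.card : ℝ≥0∞)⁻¹ * F.card) * (μ (shortVectorEvent Λ δ 1) * c) := by
              rw [this, one_mul]
          _ = _ := by ring
    _ ≤ (F.card : ℝ≥0∞)⁻¹ * (2 * N * ∫⁻ H, ∑ x ∈ F, p x H ∂μ) := by gcongr
    _ = _ := by ring

/-- An approximate regularized lattice decoder errs only if the noise is large or the channel maps
a short lattice vector to a short vector. -/
lemma exists_errorProb_le (m : ℕ) {S : Matrix (Fin n) (Fin n) ℝ} (hS : S.PosDef) {C : ℝ}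
    (hC : 0 ≤ C) {K : Set (EuclideanSpace ℝ (Fin n))} (hK : IsCompact K) (hK0 : 0 ∈ interior K) :
    ∃ κ : ℝ, 0 < κ ∧ ∀ (Λ : AddSubgroup (EuclideanSpace ℝ (Fin n)))
      (_ : ((Λ : Set (EuclideanSpace ℝ (Fin n))) ∩ K).Finite)
      (μ : Measure (Matrix (Fin m) (Fin n) ℝ)) (_ : IsProbabilityMeasure μ) (D : Decoder m n)
      (_ : IsApproxDecoder C S Λ D) (R : ℝ) (_ : 1 ≤ R),
      errorProb ((Λ : Set (EuclideanSpace ℝ (Fin n))) ∩ K) μ D ≤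
        μ (shortVectorEvent Λ (κ * R) (κ * R)) +
          stdGaussian (EuclideanSpace ℝ (Fin m)) {w | R < ‖w‖} := by
  obtain ⟨A, hA⟩ := exists_transpose_mul_self_eq hS
  obtain ⟨s, hs, hsle⟩ := exists_pos_le_norm_toEuclideanLin
    (isUnit_det_of_transpose_mul_self hS hA)
  have hSA : ∀ x, inner ℝ x (S.toEuclideanLin x) = ‖A.toEuclideanLin x‖ ^ 2 := by
    intro x
    rw [← hA, toEuclideanLin_mul_apply, ← inner_toEuclideanLin_left, real_inner_self_eq_norm_sq]
  obtain ⟨k, hk⟩ := hK.isBounded.exists_norm_le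
  obtain ⟨a, ha⟩ :=
    (hK.image A.toEuclideanLin.continuous_of_finiteDimensional).isBounded.exists_norm_le
  have hk0 : 0 ≤ k := (norm_nonneg _).trans (hk 0 (interior_subset hK0))
  -- With `AᵀA = S`, the sent codeword has metric `‖w‖² + ‖A x‖² ≤ (1 + a²) R²`, as `R ≥ 1`. Hence
  -- the metric of the output is at most `(q R)²`.
  set q := √(C * (1 + a ^ 2)) with hq
  have hq0 : 0 ≤ q := Real.sqrt_nonneg _
  have hqs : 0 ≤ q / s := by positivity
  -- The bounds to cover are `‖x̂ - x‖ ≤ (q / s) R + k` and `‖H (x̂ - x)‖ ≤ R + q R`.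
  refine ⟨q + q / s + k + 1, by positivity, fun Λ hX μ hμ D hD R hR => ?_⟩
  set κ := q + q / s + k + 1 with hκ
  have hXne : ((Λ : Set (EuclideanSpace ℝ (Fin n))) ∩ K).Nonempty :=
    ⟨0, Λ.zero_mem, interior_subset hK0⟩
  have := isProbabilityMeasure_uniformOn hX hXne
  set X := (Λ : Set (EuclideanSpace ℝ (Fin n))) ∩ K with hXdef
  have hsub : {p : EuclideanSpace ℝ (Fin n) × Matrix (Fin m) (Fin n) ℝ ×
      EuclideanSpace ℝ (Fin m) | D (p.2.1.toEuclideanLin p.1 + p.2.2) p.2.1 ≠ p.1} ⊆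
      (Xᶜ ×ˢ Set.univ) ∪ ((Set.univ ×ˢ (shortVectorEvent Λ (κ * R) (κ * R) ×ˢ Set.univ)) ∪
        (Set.univ ×ˢ (Set.univ ×ˢ {w | R < ‖w‖}))) := by
    rintro ⟨x, H, w⟩ herr
    by_cases hx : x ∈ X
    swap
    · exact Or.inl ⟨hx, trivial⟩
    by_cases hw : R < ‖w‖
    · exact Or.inr (Or.inr ⟨trivial, trivial, hw⟩)
    refine Or.inr (Or.inl ⟨trivial, ?_, trivial⟩)
    rw [not_lt] at hw
    set y := H.toEuclideanLin x + w with hy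
    obtain ⟨hmem, hle⟩ := hD y H
    have h1 := hle x hx.1
    have hne : D y H ≠ x := herr
    have hax := ha _ (Set.mem_image_of_mem _ hx.2)
    have hkx := hk x hx.2
    have hR2 : 1 ≤ R ^ 2 := one_le_pow₀ hR
    have h2 : C * regMetric S y H x ≤ (q * R) ^ 2 := by
      rw [regMetric, hSA, hy, add_sub_cancel_left, mul_pow, hq, Real.sq_sqrt (by positivity),
        mul_assoc]
      gcongr
      have h3 := pow_le_pow_left₀ (norm_nonneg _) hw 2
      have h4 := pow_le_pow_left₀ (norm_nonneg _) hax 2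
      nlinarith [sq_nonneg a]
    have h3 := h1.trans h2
    rw [regMetric, hSA] at h3
    have hqR : 0 ≤ q * R := by positivity
    have h5 : ‖y - H.toEuclideanLin (D y H)‖ ≤ q * R :=
      le_of_sq_le_sq (by nlinarith [sq_nonneg ‖A.toEuclideanLin (D y H)‖]) hqR
    have h6 : ‖A.toEuclideanLin (D y H)‖ ≤ q * R :=
      le_of_sq_le_sq (by nlinarith [sq_nonneg ‖y - H.toEuclideanLin (D y H)‖]) hqR
    have h7 : ‖D y H‖ ≤ q / s * R := by
      rw [div_mul_eq_mul_div, le_div_iff₀ hs, mul_comm]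
      exact (hsle _).trans h6
    refine ⟨D y H - x, Λ.sub_mem hmem hx.1, sub_ne_zero.2 hne, ?_, ?_⟩
    · refine (norm_sub_le _ _).trans ?_
      have : 0 ≤ k * (R - 1) := mul_nonneg hk0 (by linarith)
      rw [hκ]
      nlinarith
    · have h8 : H.toEuclideanLin (D y H - x) = w - (y - H.toEuclideanLin (D y H)) := by
        rw [map_sub, hy]; abel
      rw [h8]
      refine (norm_sub_le _ _).trans ?_
      have : 0 ≤ (q / s + k) * R := by positivity
      rw [hκ]
      nlinarith
  have hcompl : uniformOn X Xᶜ = 0 := by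
    rw [uniformOn_eq_zero_iff hX, Set.inter_compl_self]
  calc errorProb X μ D
      ≤ _ := measure_mono hsub
    _ ≤ _ := (measure_union_le _ _).trans (add_le_add_right (measure_union_le _ _) _)
    _ = _ := by
      simp only [Measure.prod_prod, hcompl, measure_univ, one_mul, mul_one, zero_add]

end ShortVectors

/-! ### Diversity -/

section Diversity

variable {m n : ℕ}

/-- Translates between diversity exponents and power bounds, including the case `P = 0`. -/
lemma coe_le_neg_log_div_iff {P : ℝ≥0∞} {ρ b : ℝ} (hρ : 1 < ρ) :
    (b : EReal) ≤ -(ENNReal.log P / (Real.log ρ : EReal)) ↔ P ≤ ENNReal.ofReal (ρ ^ (-b)) := by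
  have hlog : 0 < Real.log ρ := Real.log_pos hρ
  have hpos : 0 < ρ ^ (-b) := Real.rpow_pos_of_pos (by linarith) _
  rw [EReal.le_neg, EReal.div_le_iff_le_mul (by exact_mod_cast hlog) (EReal.coe_ne_top _),
    ← ENNReal.log_le_log_iff, ENNReal.log_ofReal_of_pos hpos, Real.log_rpow (by linarith)]
  rw [← EReal.coe_neg, ← EReal.coe_mul, mul_comm]

lemma neg_log_div_anti {P Q : ℝ≥0∞} {ρ : ℝ} (hρ : 1 < ρ) (h : P ≤ Q) :
    -(ENNReal.log Q / (Real.log ρ : EReal)) ≤ -(ENNReal.log P / (Real.log ρ : EReal)) :=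
  EReal.neg_le_neg_iff.2 (EReal.div_le_div_right_of_nonneg
    (by exact_mod_cast (Real.log_pos hρ).le) (ENNReal.log_le_log_iff.2 h))

lemma scaling_eq_mul (hn : 0 < n) (T r r' : ℝ) {ρ : ℝ} (hρ : 0 < ρ) :
    scaling n T r' ρ = ρ ^ (-(2 * ((r' - r) * T / (2 * n)))) * scaling n T r ρ := by
  have : (n : ℝ) ≠ 0 := by exact_mod_cast hn.ne'
  rw [scaling, scaling, ← Real.rpow_add hρ]
  congr 1
  field_simp
  ring

/-- Passing from rate `r` to `r'` shrinks the lattice by `ρ ^ (-2ε)` with `ε = (r' - r) T / (2 n)`.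
One factor `ρ ^ (-ε)` cancels the allowed growth of the noise; the other beats the constants. -/
lemma shortVectorEvent_subset (hn : 0 < n) (L : LatticeDesign n) (T r r' : ℝ) {ρ κ δ : ℝ}
    (hρ : 0 < ρ) (hκ : κ * ρ ^ (-((r' - r) * T / (2 * n))) ≤ min 1 δ) :
    shortVectorEvent (m := m) (L.scaledLattice T r ρ) (κ * ρ ^ ((r' - r) * T / (2 * n)))
      (κ * ρ ^ ((r' - r) * T / (2 * n))) ⊆ shortVectorEvent (L.scaledLattice T r' ρ) δ 1 := by
  rintro H ⟨_, ⟨z, rfl⟩, hd0, hd1, hd2⟩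
  set ε := (r' - r) * T / (2 * n)
  have hθ : 0 < ρ ^ (-(2 * ε)) := Real.rpow_pos_of_pos hρ _
  have hprod : ρ ^ (-(2 * ε)) * (κ * ρ ^ ε) = κ * ρ ^ (-ε) := by
    rw [mul_left_comm, ← Real.rpow_add hρ]
    congr 2
    ring
  have heq : scaling n T r' ρ • intComb L.G z =
      ρ ^ (-(2 * ε)) • (scaling n T r ρ • intComb L.G z) := by
    rw [smul_smul, ← scaling_eq_mul hn T r r' hρ]
  refine ⟨scaling n T r' ρ • intComb L.G z, ⟨z, rfl⟩, ?_, ?_, ?_⟩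
  · rw [heq]
    exact smul_ne_zero hθ.ne' hd0
  · rw [heq, norm_smul, Real.norm_of_nonneg hθ.le]
    refine (mul_le_mul_of_nonneg_left hd1 hθ.le).trans ?_
    rw [hprod]
    exact hκ.trans (min_le_right _ _)
  · rw [heq, map_smul, norm_smul, Real.norm_of_nonneg hθ.le]
    refine (mul_le_mul_of_nonneg_left hd2 hθ.le).trans ?_
    rw [hprod]
    exact hκ.trans (min_le_left _ _)

lemma tendsto_const_mul_rpow_neg (a : ℝ) {ε : ℝ} (hε : 0 < ε) :
    Tendsto (fun ρ : ℝ => a * ρ ^ (-ε)) atTop (𝓝 0) := by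
  simpa using (tendsto_rpow_neg_atTop hε).const_mul a

/-- The error probability of an approximate regularized lattice decoder decays at least as fast as
that of maximum-likelihood decoding at any larger multiplexing gain. -/
lemma eventually_errorProb_le (hn : 0 < n) {T : ℝ} (hT : 0 < T) (L : LatticeDesign n)
    {S : Matrix (Fin n) (Fin n) ℝ} (hS : S.PosDef) {C : ℝ} (hC : 0 ≤ C)
    {μ : ℝ → Measure (Matrix (Fin m) (Fin n) ℝ)} (hμ : ∀ ρ, IsProbabilityMeasure (μ ρ))
    {r r' : ℝ} (hr : r < r') {D : ℝ → Decoder m n}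
    (hD : ∀ ρ : ℝ, 0 < ρ → IsApproxDecoder C S (L.scaledLattice T r ρ) (D ρ))
    {d : EReal} (hd : HasMLDiversity L T μ r' d) {a b : ℝ} (hab : a < b) (hbd : (b : EReal) < d) :
    ∀ᶠ ρ in atTop,
      errorProb (L.codebook T r ρ) (μ ρ) (D ρ) ≤ ENNReal.ofReal (ρ ^ (-a)) := by
  obtain ⟨D', hD', hdiv⟩ := hd
  obtain ⟨M, δ, hM, hδ, hlow⟩ :=
    exists_mul_measure_shortVectorEvent_le m L.region_compact L.zero_mem_interior
  obtain ⟨κ, hκ, hup⟩ := exists_errorProb_le m hS hC L.region_compact L.zero_mem_interior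
  set ε := (r' - r) * T / (2 * n) with hε
  have hε0 : 0 < ε := by
    have : (0 : ℝ) < n := by exact_mod_cast hn
    have : 0 < r' - r := sub_pos.2 hr
    positivity
  -- A moment of order `k` makes the tail beyond `ρ ^ ε` decay at least as fast as `ρ ^ (-b)`.
  obtain ⟨k, hk⟩ := exists_nat_ge (b / ε)
  obtain ⟨c, hc, htail⟩ := exists_stdGaussian_tail_le m k
  have hkb : b ≤ k * ε := (div_le_iff₀ hε0).1 hk
  have hsmall := (tendsto_const_mul_rpow_neg κ hε0).eventually_le_const
    (lt_min one_pos hδ)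
  have hsmall' := (tendsto_const_mul_rpow_neg (M + c) (sub_pos.2 hab)).eventually_le_const one_pos
  filter_upwards [hsmall, hsmall', eventually_gt_atTop 1, hdiv.eventually_const_lt hbd]
    with ρ h1 h2 hρ h3
  have hρ0 : 0 < ρ := by linarith
  have hML : errorProb (L.codebook T r' ρ) (μ ρ) (D' ρ) ≤ ENNReal.ofReal (ρ ^ (-b)) :=
    (coe_le_neg_log_div_iff hρ).1 h3.le
  have hR : 1 ≤ ρ ^ ε := Real.one_le_rpow hρ.le hε0.le
  have hE : μ ρ (shortVectorEvent (L.scaledLattice T r ρ) (κ * ρ ^ ε) (κ * ρ ^ ε)) ≤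
      ENNReal.ofReal M * ENNReal.ofReal (ρ ^ (-b)) := by
    refine (measure_mono (shortVectorEvent_subset hn L T r r' hρ0 h1)).trans ?_
    refine (hlow (L.scaledSubgroup T r' ρ) (L.codebook_finite T r' hρ0) (μ ρ) (hμ ρ) (D' ρ)
      (hD' ρ hρ0).measurable).trans ?_
    exact mul_le_mul_right hML _
  have hG : stdGaussian (EuclideanSpace ℝ (Fin m)) {w | ρ ^ ε < ‖w‖} ≤
      ENNReal.ofReal (c * ρ ^ (-b)) := by
    refine (htail (ρ ^ ε) (by positivity)).trans (ENNReal.ofReal_le_ofReal ?_)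
    gcongr
    rw [← Real.rpow_natCast, ← Real.rpow_mul hρ0.le, ← Real.rpow_neg hρ0.le]
    exact Real.rpow_le_rpow_of_exponent_le hρ.le (by linarith [mul_comm ε (k : ℝ)])
  calc errorProb (L.codebook T r ρ) (μ ρ) (D ρ)
      ≤ _ := hup (L.scaledSubgroup T r ρ) (L.codebook_finite T r hρ0) (μ ρ) (hμ ρ) (D ρ)
        (hD ρ hρ0) (ρ ^ ε) hR
    _ ≤ ENNReal.ofReal M * ENNReal.ofReal (ρ ^ (-b)) + ENNReal.ofReal (c * ρ ^ (-b)) :=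
        add_le_add hE hG
    -- The gap between `a` and `b` absorbs the constant `M + c` for large `ρ`.
    _ = ENNReal.ofReal ((M + c) * ρ ^ (-(b - a)) * ρ ^ (-a)) := by
        rw [← ENNReal.ofReal_mul hM, ← ENNReal.ofReal_add (by positivity) (by positivity),
          mul_assoc, ← Real.rpow_add hρ0]
        congr 1
        rw [show -(b - a) + -a = -b by ring]
        ring
    _ ≤ ENNReal.ofReal (ρ ^ (-a)) := by
        refine ENNReal.ofReal_le_ofReal ?_
        exact mul_le_of_le_one_left (by positivity) h2

/-- Approximate regularized lattice decoders are DMT optimal. -/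
theorem hasDiversity_of_isApproxDecoder (hn : 0 < n) {T : ℝ} (hT : 0 < T) (L : LatticeDesign n)
    {S : Matrix (Fin n) (Fin n) ℝ} (hS : S.PosDef) {C : ℝ} (hC : 0 ≤ C)
    {μ : ℝ → Measure (Matrix (Fin m) (Fin n) ℝ)} (hμ : ∀ ρ, IsProbabilityMeasure (μ ρ))
    {r : ℝ} {dML : ℝ → EReal} (hML : ∀ᶠ r' in 𝓝[≥] r, HasMLDiversity L T μ r' (dML r'))
    (hcont : ContinuousWithinAt dML (Set.Ici r) r) {D : ℝ → Decoder m n}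
    (hD : ∀ ρ : ℝ, 0 < ρ → IsApproxDecoder C S (L.scaledLattice T r ρ) (D ρ)) :
    HasDiversity (fun ρ => errorProb (L.codebook T r ρ) (μ ρ) (D ρ)) (dML r) := by
  refine tendsto_order.2 ⟨fun a ha => ?_, fun a ha => ?_⟩
  · obtain ⟨b, hab, hb⟩ := EReal.lt_iff_exists_real_btwn.1 ha
    obtain ⟨b', hbb, hb'⟩ := EReal.lt_iff_exists_real_btwn.1 hb
    -- Right continuity supplies a strictly larger rate `r'` whose ML diversity still exceeds `b'`.
    have hev : ∀ᶠ r' in 𝓝[>] r, HasMLDiversity L T μ r' (dML r') ∧ (b' : EReal) < dML r' :=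
      (hML.and (hcont.eventually_const_lt hb')).filter_mono
        (nhdsWithin_mono r Set.Ioi_subset_Ici_self)
    obtain ⟨r', ⟨hr'ML, hr'b⟩, hr'⟩ := (hev.and self_mem_nhdsWithin).exists
    filter_upwards [eventually_errorProb_le hn hT L hS hC hμ hr' hD hr'ML
      (EReal.coe_lt_coe_iff.1 hbb) hr'b, eventually_gt_atTop 1] with ρ h1 hρ
    exact hab.trans_le ((coe_le_neg_log_div_iff hρ).2 h1)
  -- The reverse bound uses ML decoding at `r` itself, which belongs to the neighbourhood `𝓝[≥] r`.
  · obtain ⟨D', hD', hdiv⟩ := hML.self_of_nhdsWithin Set.self_mem_Ici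
    filter_upwards [hdiv.eventually_lt_const ha, eventually_gt_atTop 1] with ρ h1 hρ
    have hρ0 : 0 < ρ := by linarith
    have := hμ ρ
    exact (neg_log_div_anti hρ ((hD' ρ hρ0).errorProb_le (L.codebook_finite T r hρ0)
      ⟨0, L.zero_mem_codebook T r ρ⟩ (D ρ))).trans_lt h1

end Diversity

end LatticeDMT

theorem corollary1 {m n : ℕ} (hn : 0 < n) (T : ℝ) (hT : 0 < T)
    (L : LatticeDMT.LatticeDesign n)
    (S : Matrix (Fin n) (Fin n) ℝ) (hS : S.PosDef) :
    -- for every rate and SNR, both kinds of decoders exist and are approximation algorithms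
    (∀ r ρ : ℝ, 0 ≤ r → 0 < ρ →
      (∃ D : LatticeDMT.Decoder m n, LatticeDMT.IsLRAidedLinear L T r ρ S D) ∧
      (∃ D : LatticeDMT.Decoder m n, LatticeDMT.IsLRAidedSIC L T r ρ S D) ∧
      (∀ D : LatticeDMT.Decoder m n, LatticeDMT.IsLRAidedLinear L T r ρ S D →
        LatticeDMT.IsApproxDecoder ((1 + 2 * (n : ℝ) * (9 / 2 : ℝ) ^ ((n : ℝ) / 2)) ^ 2) S
          (L.scaledLattice T r ρ) D) ∧
      (∀ D : LatticeDMT.Decoder m n, LatticeDMT.IsLRAidedSIC L T r ρ S D →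
        LatticeDMT.IsApproxDecoder (((2 : ℝ) ^ ((n : ℝ) / 2)) ^ 2) S
          (L.scaledLattice T r ρ) D)) ∧
    -- both kinds of decoders are DMT optimal
    (∀ μ : ℝ → MeasureTheory.Measure (Matrix (Fin m) (Fin n) ℝ),
      (∀ ρ, MeasureTheory.IsProbabilityMeasure (μ ρ)) →
      ∀ (r : ℝ), 0 ≤ r → ∀ dML : ℝ → EReal,
      (∀ᶠ r' in nhdsWithin r (Set.Ici r), LatticeDMT.HasMLDiversity L T μ r' (dML r')) →
      ContinuousWithinAt dML (Set.Ici r) r →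
      (∀ D : ℝ → LatticeDMT.Decoder m n,
        (∀ ρ : ℝ, 0 < ρ → LatticeDMT.IsLRAidedLinear L T r ρ S (D ρ)) →
        LatticeDMT.HasDiversity
          (fun ρ => LatticeDMT.errorProb (L.codebook T r ρ) (μ ρ) (D ρ)) (dML r)) ∧
      (∀ D : ℝ → LatticeDMT.Decoder m n,
        (∀ ρ : ℝ, 0 < ρ → LatticeDMT.IsLRAidedSIC L T r ρ S (D ρ)) →
        LatticeDMT.HasDiversity
          (fun ρ => LatticeDMT.errorProb (L.codebook T r ρ) (μ ρ) (D ρ)) (dML r))) := by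
  have hlin : 0 ≤ (1 + 2 * (n : ℝ) * (9 / 2 : ℝ) ^ ((n : ℝ) / 2)) ^ 2 := sq_nonneg _
  have hsic : 0 ≤ ((2 : ℝ) ^ ((n : ℝ) / 2)) ^ 2 := sq_nonneg _
  refine ⟨fun r ρ _ hρ => ⟨?_, ?_, fun D hD => hD.isApproxDecoder hρ hS,
    fun D hD => hD.isApproxDecoder hρ hS⟩, fun μ hμ r _ dML hML hcont =>
    ⟨fun D hD => ?_, fun D hD => ?_⟩⟩
  · exact LatticeDMT.exists_isLRAidedDecoder (fun M t _ => LatticeDMT.exists_isRounding M t)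
      L.G_fullRank hS (LatticeDMT.scaling_pos n T r hρ).ne'
  · exact LatticeDMT.exists_isLRAidedDecoder
      (fun M t hM => LatticeDMT.exists_isNearestPlane hM t)
      L.G_fullRank hS (LatticeDMT.scaling_pos n T r hρ).ne'
  · exact LatticeDMT.hasDiversity_of_isApproxDecoder hn hT L hS hlin hμ hML hcont
      fun ρ hρ => (hD ρ hρ).isApproxDecoder hρ hS
  · exact LatticeDMT.hasDiversity_of_isApproxDecoder hn hT L hS hsic hμ hML hcont
      fun ρ hρ => (hD ρ hρ).isApproxDecoder hρ hS
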